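/- Let $\Gamma$ be a finite group and $\Gamma'\subseteq\Gamma$ a subgroup. Let $e_{\Gamma/\Gamma'}$ be the central idempotent of $\mathbb{Q}[\Gamma]$ associated to the augmentation character $a_{\Gamma/\Gamma'}=\mathrm{Ind}_{\Gamma'}^{\Gamma}1-1$, i.e. the minimal central idempotent acting as the identity on a representation with character $a_{\Gamma/\Gamma'}$, and let $e_1'=\frac{1}{|\Gamma'|}\sum_{\tau\in\Gamma'}\tau$. Call a prime $p$ good for $e_{\Gamma/\Gamma'}$ if $e_{\Gamma/\Gamma'}\in\mathbb{Z}_{(p)}[\Gamma]$ and $e_{\Gamma/\Gamma'}\mathbb{Z}_{(p)}[\Gamma]$ is a maximal $\mathbb{Z}_{(p)}$-order in $e_{\Gamma/\Gamma'}\mathbb{Q}[\Gamma]$. Let $S$ be a finite set of primes that are good for $e_{\Gamma/\Gamma'}$, let $\mathbb{Z}_S\subseteq\mathbb{Q}$ be the localization of $\mathbb{Z}$ at the nonzero integers not divisible by any prime in $S$, and let $\mathfrak{O}\subseteq\mathbb{Q}[\Gamma]$ be a maximal $\mathbb{Z}_S$-order containing $\mathbb{Z}_S[\Gamma]$. Write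 ${}^{\Gamma'}M$ for the elements of $M$ fixed by $\Gamma'$ acting on the left, regard $e_{\Gamma/\Gamma'}\mathfrak{O}$ as a ring with identity $e_{\Gamma/\Gamma'}$, and let \[\mathfrak{o}={}^{\Gamma'}(e_{\Gamma/\Gamma'}\mathfrak{O}e_1'),\] a ring with identity $e_{\Gamma/\Gamma'}e_1'$ under the multiplication of $\mathbb{Q}[\Gamma]$. Then $e_{\Gamma/\Gamma'}\mathfrak{O}$ and $\mathfrak{o}$ are Morita equivalent (as $\mathbb{Z}_S$-algebras): the functors \[{}^{\Gamma'}(e_{\Gamma/\Gamma'}\mathfrak{O})\otimes_{e_{\Gamma/\Gamma'}\mathfrak{O}}-\;:\;e_{\Gamma/\Gamma'}\mathfrak{O}\text{-Mod}\to\mathfrak{o}\text{-Mod},\qquad e_{\Gamma/\Gamma'}\mathfrak{O}e_1'\otimes_{\mathfrak{o}}-\;:\;\mathfrak{o}\text{-Mod}\to e_{\Gamma/\Gamma'}\mathfrak{O}\text{-Mod}\] are mutually inverse equivalences of categories, the bimodule structures being given by multiplication in $\mathbb{Q}[\Gamma]$. Moreover, for every left $e_{\Gamma/\Gamma'}\mathfrak{O}$-module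 $G$ (on which $\gamma\in\Gamma$ acts through $e_{\Gamma/\Gamma'}\gamma$), the rule $(\sigma e_1')\cdot g=\sigma g$, for $\sigma\in e_{\Gamma/\Gamma'}\mathfrak{O}$ with $\sigma e_1'\in\mathfrak{o}$, makes ${}^{\Gamma'}G$ an $\mathfrak{o}$-module, and $x\otimes g\mapsto xg$ is an isomorphism of $\mathfrak{o}$-modules ${}^{\Gamma'}(e_{\Gamma/\Gamma'}\mathfrak{O})\otimes_{e_{\Gamma/\Gamma'}\mathfrak{O}}G\to{}^{\Gamma'}G$. -/

import Mathlib

open CategoryTheory TensorProduct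

universe u v

noncomputable section

namespace HeckeModel

/-! ### Rings and bimodules inside an ambient ring -/

section Ambient

/-- An `R`-submodule of `A`, closed under multiplication, which is a ring with identity `one'`;
the identity need not be the identity of `A`. -/
structure SubRingWithOne (R A : Type*) [CommRing R] [Ring A] [Algebra R A]
    extends Submodule R A where
  one' : A
  one_mem' : one' ∈ carrier
  mul_mem' : ∀ {x y : A}, x ∈ carrier → y ∈ carrier → x * y ∈ carrier
  one_mul' : ∀ {x : A}, x ∈ carrier → one' * x = x
  mul_one' : ∀ {x : A}, x ∈ carrier → x * one' = x

variable {R : Type*} {A : Type u} [CommRing R] [Ring A] [Algebra R A]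

/-- The underlying type of `B`. -/
def SubRingWithOne.Elt (B : SubRingWithOne R A) : Type u := B.toSubmodule

instance (B : SubRingWithOne R A) : AddCommGroup B.Elt :=
  inferInstanceAs (AddCommGroup B.toSubmodule)

instance (B : SubRingWithOne R A) : Module R B.Elt :=
  inferInstanceAs (Module R B.toSubmodule)

instance (B : SubRingWithOne R A) : Ring B.Elt where
  __ := (inferInstance : AddCommGroup B.Elt)
  mul x y := ⟨x.1 * y.1, B.mul_mem' x.2 y.2⟩
  one := ⟨B.one', B.one_mem'⟩
  mul_assoc x y z := Subtype.ext (mul_assoc x.1 y.1 z.1)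
  one_mul x := Subtype.ext (B.one_mul' x.2)
  mul_one x := Subtype.ext (B.mul_one' x.2)
  left_distrib x y z := Subtype.ext (mul_add x.1 y.1 z.1)
  right_distrib x y z := Subtype.ext (add_mul x.1 y.1 z.1)
  zero_mul x := Subtype.ext (zero_mul x.1)
  mul_zero x := Subtype.ext (mul_zero x.1)

instance (B : SubRingWithOne R A) : Algebra R B.Elt :=
  Algebra.ofModule (fun r x y => Subtype.ext (smul_mul_assoc r x.1 y.1))
    (fun r x y => Subtype.ext (mul_smul_comm r x.1 y.1))

/-- An `R`-submodule of `A` which is a `(B, C)`-bimodule under multiplication in `A`. -/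
structure SubBimodule (B C : SubRingWithOne R A) extends Submodule R A where
  left_mem' : ∀ {b x : A}, b ∈ B.carrier → x ∈ carrier → b * x ∈ carrier
  right_mem' : ∀ {x c : A}, x ∈ carrier → c ∈ C.carrier → x * c ∈ carrier
  one_left' : ∀ {x : A}, x ∈ carrier → B.one' * x = x
  one_right' : ∀ {x : A}, x ∈ carrier → x * C.one' = x

/-- The underlying type of `P`. -/
def SubBimodule.Elt {B C : SubRingWithOne R A} (P : SubBimodule B C) : Type u := P.toSubmodule

variable {B C : SubRingWithOne R A}

instance (P : SubBimodule B C) : AddCommGroup P.Elt :=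
  inferInstanceAs (AddCommGroup P.toSubmodule)

instance (P : SubBimodule B C) : Module B.Elt P.Elt where
  smul b x := ⟨b.1 * x.1, P.left_mem' b.2 x.2⟩
  one_smul x := Subtype.ext (P.one_left' x.2)
  mul_smul b c x := Subtype.ext (mul_assoc b.1 c.1 x.1)
  smul_zero b := Subtype.ext (mul_zero b.1)
  smul_add b x y := Subtype.ext (mul_add b.1 x.1 y.1)
  add_smul b c x := Subtype.ext (add_mul b.1 c.1 x.1)
  zero_smul x := Subtype.ext (zero_mul x.1)

instance (P : SubBimodule B C) : Module C.Eltᵐᵒᵖ P.Elt where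
  smul c x := ⟨x.1 * c.unop.1, P.right_mem' x.2 c.unop.2⟩
  one_smul x := Subtype.ext (P.one_right' x.2)
  mul_smul c d x := Subtype.ext (mul_assoc x.1 d.unop.1 c.unop.1).symm
  smul_zero c := Subtype.ext (zero_mul c.unop.1)
  smul_add c x y := Subtype.ext (add_mul x.1 y.1 c.unop.1)
  add_smul c d x := Subtype.ext (mul_add x.1 c.unop.1 d.unop.1)
  zero_smul x := Subtype.ext (mul_zero x.1)

instance (P : SubBimodule B C) : SMulCommClass B.Elt C.Eltᵐᵒᵖ P.Elt where
  smul_comm b c x := Subtype.ext (mul_assoc b.1 x.1 c.unop.1).symm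

end Ambient

/-! ### Tensor product over a noncommutative ring -/

section Tensor

variable (T : Type*) (R : Type*) [Ring T] [Ring R]
variable (M : Type*) [AddCommGroup M] [Module T M] [Module Rᵐᵒᵖ M] [SMulCommClass T Rᵐᵒᵖ M]

/-- The relations `(m r) ⊗ n = m ⊗ (r n)`. As `M` is a `(T, R)`-bimodule, the set of these
relations is stable under `T`, so its `T`-span is the additive subgroup it generates. -/
def tensorRel (N : Type*) [AddCommGroup N] [Module R N] : Submodule T (M ⊗[ℤ] N) :=
  Submodule.span T {t | ∃ (m : M) (r : R) (n : N),
    t = (MulOpposite.op r • m) ⊗ₜ[ℤ] n - m ⊗ₜ[ℤ] (r • n)}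

/-- The tensor product `M ⊗_R N` of a `(T, R)`-bimodule `M` and a left `R`-module `N`,
as a left `T`-module. -/
abbrev BTensor (N : Type*) [AddCommGroup N] [Module R N] : Type _ :=
  (M ⊗[ℤ] N) ⧸ tensorRel T R M N

variable {N : Type*} [AddCommGroup N] [Module R N] {M} in
/-- The pure tensor `m ⊗ n` in `M ⊗_R N`. -/
def btmul (m : M) (n : N) : BTensor T R M N :=
  (tensorRel T R M N).mkQ (m ⊗ₜ[ℤ] n)

variable {N N' : Type*} [AddCommGroup N] [Module R N] [AddCommGroup N'] [Module R N'] in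
/-- The map `id ⊗ f : M ⊗_R N → M ⊗_R N'`. -/
def btensorMap (f : N →ₗ[R] N') : BTensor T R M N →ₗ[T] BTensor T R M N' :=
  Submodule.mapQ (tensorRel T R M N) (tensorRel T R M N')
    (TensorProduct.AlgebraTensorModule.lTensor T M (f.restrictScalars ℤ)) (by
      rw [tensorRel, Submodule.span_le]
      rintro _ ⟨m, r, n, rfl⟩
      refine Submodule.subset_span ⟨m, r, f n, ?_⟩
      simp)

/-- The functor `M ⊗_R - : R-Mod ⥤ T-Mod` for a `(T, R)`-bimodule `M`. -/
def tensorFunctor (T R M : Type u) [Ring T] [Ring R] [AddCommGroup M] [Module T M]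
    [Module Rᵐᵒᵖ M] [SMulCommClass T Rᵐᵒᵖ M] :
    ModuleCat.{max u v} R ⥤ ModuleCat.{max u v} T where
  obj N := ModuleCat.of T (BTensor T R M N)
  map f := ModuleCat.ofHom (btensorMap T R M f.hom)
  map_id N := ModuleCat.hom_ext (Submodule.linearMap_qext _ (by
    ext m n
    simp [btensorMap]))
  map_comp f g := ModuleCat.hom_ext (Submodule.linearMap_qext _ (by
    ext m n
    simp [btensorMap]))

end Tensor

/-! ### Orders and good primes -/

/-- `ℤ_S`, the localization of `ℤ` at the nonzero integers not divisible by any prime in `S`,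
as a subring of `ℚ`. -/
def zS (S : Set Nat.Primes) : Subring ℚ where
  carrier := {q | ∀ p ∈ S, ¬ ((p : ℕ) ∣ q.den)}
  zero_mem' p _ := by simpa using p.2.one_lt.ne'
  one_mem' p _ := by simpa using p.2.one_lt.ne'
  neg_mem' {q} hq p hp := by simpa using hq p hp
  add_mem' {a b} ha hb p hp h :=
    (p.2.dvd_mul.1 (h.trans (Rat.add_den_dvd a b))).elim (ha p hp) (hb p hp)
  mul_mem' {a b} ha hb p hp h :=
    (p.2.dvd_mul.1 (h.trans (Rat.mul_den_dvd a b))).elim (ha p hp) (hb p hp)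

/-- `L` is an `R`-order in the `ℚ`-algebra `u A u` (with identity `u`), for an idempotent `u` of the
`ℚ`-algebra `A` and a subring `R` of `ℚ`: a subring with identity `u`, finitely generated over
`R`, whose `ℚ`-span is `u A u`. -/
structure IsOrder (R : Subring ℚ) {A : Type*} [Ring A] [Algebra ℚ A] (u : A)
    (L : Submodule R A) : Prop where
  one_mem : u ∈ L
  mul_mem : ∀ x ∈ L, ∀ y ∈ L, x * y ∈ L
  one_mul : ∀ x ∈ L, u * x = x
  mul_one : ∀ x ∈ L, x * u = x
  fg : L.FG
  span : ∀ x : A, u * x * u ∈ Submodule.span ℚ (L : Set A)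

/-- `L` is a maximal `R`-order in `u A u`. -/
def IsMaximalOrder (R : Subring ℚ) {A : Type*} [Ring A] [Algebra ℚ A] (u : A)
    (L : Submodule R A) : Prop :=
  IsOrder R u L ∧ ∀ L' : Submodule R A, IsOrder R u L' → L ≤ L' → L' = L

variable {Γ : Type u} [Group Γ]

/-- The group ring `R[Γ]` as an `R`-submodule of `ℚ[Γ]`. -/
def groupRing (R : Subring ℚ) (Γ : Type u) [Group Γ] : Submodule R (MonoidAlgebra ℚ Γ) :=
  Submodule.span R (Set.range (MonoidAlgebra.of ℚ Γ))

/-- The prime `p` is good for `e`: `e ∈ ℤ_(p)[Γ]` and `e ℤ_(p)[Γ]` is a maximal `ℤ_(p)`-order in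
`e ℚ[Γ]` (used for central idempotents `e`). -/
def IsGoodPrime (p : Nat.Primes) (e : MonoidAlgebra ℚ Γ) : Prop :=
  e ∈ groupRing (zS {p}) Γ ∧
    IsMaximalOrder (zS {p}) e ((groupRing (zS {p}) Γ).map (LinearMap.mulLeft (zS {p}) e))

/-! ### The idempotents -/

/-- `x` acts as the identity on the augmentation representation, the subrepresentation of the
permutation representation `ℚ[Γ/Γ']` of the vectors with coordinate sum zero; its character is
`Ind_{Γ'}^Γ 1 - 1`. -/
def ActsAsOne (Γ' : Subgroup Γ) (x : MonoidAlgebra ℚ Γ) : Prop :=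
  ∀ w : MonoidAlgebra ℚ (Γ ⧸ Γ'), (w.coeff.sum fun _ c => c) = 0 →
    (Representation.ofMulAction ℚ Γ (Γ ⧸ Γ')).asAlgebraHom x w = w

/-- `e` is the minimal central idempotent of `ℚ[Γ]` acting as the identity on the augmentation
representation. -/
structure IsAugIdempotent (Γ' : Subgroup Γ) (e : MonoidAlgebra ℚ Γ) : Prop where
  idem : e * e = e
  central : ∀ x, e * x = x * e
  acts : ActsAsOne Γ' e
  minimal : ∀ f : MonoidAlgebra ℚ Γ, f * f = f → (∀ x, f * x = x * f) → ActsAsOne Γ' f →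
    e * f = e

theorem IsAugIdempotent.unique {Γ' : Subgroup Γ} {e f : MonoidAlgebra ℚ Γ}
    (he : IsAugIdempotent Γ' e) (hf : IsAugIdempotent Γ' f) : e = f := by
  rw [← he.minimal f hf.idem hf.central hf.acts, he.central f,
    hf.minimal e he.idem he.central he.acts]

theorem exists_augIdempotent [Finite Γ] (Γ' : Subgroup Γ) :
    ∃ e : MonoidAlgebra ℚ Γ, IsAugIdempotent Γ' e := by
  classical
  have hfin : FiniteDimensional ℚ (MonoidAlgebra ℚ Γ) := inferInstance
  let d : MonoidAlgebra ℚ Γ → ℕ := fun e =>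
    Module.finrank ℚ (LinearMap.range (LinearMap.mulLeft ℚ e))
  let Q : MonoidAlgebra ℚ Γ → Prop := fun e =>
    e * e = e ∧ (∀ x, e * x = x * e) ∧ ActsAsOne Γ' e
  have h1 : Q 1 := ⟨one_mul 1, fun x => by simp, fun w _ => by simp⟩
  have hex : ∃ n, ∃ e, Q e ∧ d e = n := ⟨_, 1, h1, rfl⟩
  obtain ⟨e, he, hd⟩ := Nat.find_spec hex
  refine ⟨e, he.1, he.2.1, he.2.2, fun f hf hfc hfa => ?_⟩
  have hef : Q (e * f) := by
    refine ⟨?_, fun x => ?_, fun w hw => ?_⟩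
    · rw [mul_assoc, ← mul_assoc f e f, ← he.2.1 f, mul_assoc e f f, hf, ← mul_assoc, he.1]
    · rw [mul_assoc, hfc, ← mul_assoc, he.2.1, mul_assoc]
    · rw [map_mul, Module.End.mul_apply, hfa w hw, he.2.2 w hw]
  have hle : LinearMap.range (LinearMap.mulLeft ℚ (e * f)) ≤
      LinearMap.range (LinearMap.mulLeft ℚ e) := by
    rintro _ ⟨x, rfl⟩
    exact ⟨f * x, (mul_assoc _ _ _).symm⟩
  have hdim : d e ≤ d (e * f) := by
    rw [hd]
    exact Nat.find_min' hex ⟨_, hef, rfl⟩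
  have heq := Submodule.eq_of_le_of_finrank_le hle hdim
  have hmem : e ∈ LinearMap.range (LinearMap.mulLeft ℚ (e * f)) := by
    rw [heq]
    exact ⟨1, by simp⟩
  obtain ⟨x, hx⟩ := hmem
  have hx' : e * f * x = e := hx
  calc e * f = e * f * x * f := by rw [hx']
    _ = e * f * x := by
      rw [mul_assoc (e * f) x f, ← hfc x, ← mul_assoc, mul_assoc e f f, hf]
    _ = e := hx'

/-- The central idempotent `e_{Γ/Γ'}` associated to the augmentation character. -/
def augIdem [Finite Γ] (Γ' : Subgroup Γ) : MonoidAlgebra ℚ Γ :=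
  (exists_augIdempotent Γ').choose

theorem augIdem_spec [Finite Γ] (Γ' : Subgroup Γ) : IsAugIdempotent Γ' (augIdem Γ') :=
  (exists_augIdempotent Γ').choose_spec

/-- The idempotent `e₁' = |Γ'|⁻¹ ∑_{τ ∈ Γ'} τ`. -/
def trivIdem (Γ' : Subgroup Γ) : MonoidAlgebra ℚ Γ :=
  (Nat.card Γ' : ℚ)⁻¹ • ∑ᶠ τ : Γ', MonoidAlgebra.of ℚ Γ (τ : Γ)

section

variable [Finite Γ] (Γ' : Subgroup Γ)

theorem of_mul_trivIdem (τ : Γ') :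
    MonoidAlgebra.of ℚ Γ (τ : Γ) * trivIdem Γ' = trivIdem Γ' := by
  have := Fintype.ofFinite Γ'
  rw [trivIdem, finsum_eq_sum_of_fintype, mul_smul_comm, Finset.mul_sum]
  congr 1
  refine Fintype.sum_equiv (Equiv.mulLeft τ) _ _ fun σ => ?_
  simp [MonoidAlgebra.single_mul_single]

theorem trivIdem_mul {x : MonoidAlgebra ℚ Γ}
    (hx : ∀ τ ∈ Γ', MonoidAlgebra.of ℚ Γ τ * x = x) : trivIdem Γ' * x = x := by
  have := Fintype.ofFinite Γ'
  rw [trivIdem, finsum_eq_sum_of_fintype, smul_mul_assoc, Finset.sum_mul,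
    Finset.sum_congr rfl (fun (τ : Γ') _ => hx (τ : Γ) τ.2), Finset.sum_const, Finset.card_univ,
    ← Nat.card_eq_fintype_card, ← Nat.cast_smul_eq_nsmul ℚ, smul_smul, inv_mul_cancel₀, one_smul]
  exact_mod_cast Nat.card_pos.ne'

theorem trivIdem_idem : trivIdem Γ' * trivIdem Γ' = trivIdem Γ' :=
  trivIdem_mul Γ' fun τ hτ => of_mul_trivIdem Γ' ⟨τ, hτ⟩

end

/-! ### The rings `e_{Γ/Γ'} O` and `o`, and the bimodules -/

section Rings

variable [Finite Γ] {R : Subring ℚ} (Γ' : Subgroup Γ) (O : Subalgebra R (MonoidAlgebra ℚ Γ))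

/-- The ring `e_{Γ/Γ'} O`, with identity `e_{Γ/Γ'}`. -/
def eO : SubRingWithOne R (MonoidAlgebra ℚ Γ) where
  carrier := {a | ∃ x ∈ O, a = augIdem Γ' * x}
  zero_mem' := ⟨0, O.zero_mem, by simp⟩
  add_mem' := by
    rintro _ _ ⟨x, hx, rfl⟩ ⟨y, hy, rfl⟩
    exact ⟨x + y, O.add_mem hx hy, (mul_add _ _ _).symm⟩
  smul_mem' := by
    rintro r _ ⟨x, hx, rfl⟩
    exact ⟨r • x, O.smul_mem hx r, (mul_smul_comm _ _ _).symm⟩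
  one' := augIdem Γ'
  one_mem' := ⟨1, O.one_mem, by simp⟩
  mul_mem' := by
    rintro _ _ ⟨x, hx, rfl⟩ ⟨y, hy, rfl⟩
    refine ⟨x * y, O.mul_mem hx hy, ?_⟩
    have h := augIdem_spec Γ'
    rw [mul_assoc, ← mul_assoc x, ← h.central x, mul_assoc, ← mul_assoc, h.idem]
  one_mul' := by
    rintro _ ⟨x, hx, rfl⟩
    rw [← mul_assoc, (augIdem_spec Γ').idem]
  mul_one' := by
    rintro _ ⟨x, hx, rfl⟩
    rw [← (augIdem_spec Γ').central, ← mul_assoc, (augIdem_spec Γ').idem]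

/-- The integral model `o = ^{Γ'}(e_{Γ/Γ'} O e₁')` of the Hecke algebra, with identity
`e_{Γ/Γ'} e₁'`. -/
def heckeOrder : SubRingWithOne R (MonoidAlgebra ℚ Γ) where
  carrier := {a | (∃ x ∈ eO Γ' O |>.carrier, a = x * trivIdem Γ') ∧
    ∀ τ ∈ Γ', MonoidAlgebra.of ℚ Γ τ * a = a}
  zero_mem' := ⟨⟨0, (eO Γ' O).zero_mem', by simp⟩, by simp⟩
  add_mem' := by
    rintro _ _ ⟨⟨x, hx, rfl⟩, hx'⟩ ⟨⟨y, hy, rfl⟩, hy'⟩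
    refine ⟨⟨x + y, (eO Γ' O).add_mem' hx hy, (add_mul _ _ _).symm⟩, fun τ hτ => ?_⟩
    rw [mul_add, hx' τ hτ, hy' τ hτ]
  smul_mem' := by
    rintro r _ ⟨⟨x, hx, rfl⟩, hx'⟩
    refine ⟨⟨r • x, (eO Γ' O).smul_mem' r hx, (smul_mul_assoc _ _ _).symm⟩, fun τ hτ => ?_⟩
    rw [mul_smul_comm, hx' τ hτ]
  one' := augIdem Γ' * trivIdem Γ'
  one_mem' := by
    refine ⟨⟨_, (eO Γ' O).one_mem', rfl⟩, fun τ hτ => ?_⟩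
    rw [← mul_assoc, ← (augIdem_spec Γ').central, mul_assoc, of_mul_trivIdem Γ' ⟨τ, hτ⟩]
  mul_mem' := by
    rintro _ b ⟨⟨x, hx, rfl⟩, hx'⟩ ⟨⟨y, hy, rfl⟩, hy'⟩
    refine ⟨⟨x * y, (eO Γ' O).mul_mem' hx hy, ?_⟩, fun τ hτ => ?_⟩
    · rw [mul_assoc, trivIdem_mul Γ' hy', mul_assoc]
    · rw [← mul_assoc, hx' τ hτ]
  one_mul' := by
    rintro _ ⟨⟨x, hx, rfl⟩, hx'⟩
    rw [mul_assoc, trivIdem_mul Γ' hx', ← mul_assoc]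
    congr 1
    exact (eO Γ' O).one_mul' hx
  mul_one' := by
    rintro _ ⟨⟨x, hx, rfl⟩, hx'⟩
    rw [← mul_assoc, ← (augIdem_spec Γ').central, ← mul_assoc, mul_assoc, trivIdem_idem]
    congr 1
    exact (eO Γ' O).one_mul' hx

/-- The `(o, e_{Γ/Γ'} O)`-bimodule `^{Γ'}(e_{Γ/Γ'} O)`. -/
def leftInv : SubBimodule (heckeOrder Γ' O) (eO Γ' O) where
  carrier := {a | a ∈ (eO Γ' O).carrier ∧ ∀ τ ∈ Γ', MonoidAlgebra.of ℚ Γ τ * a = a}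
  zero_mem' := ⟨(eO Γ' O).zero_mem', by simp⟩
  add_mem' := by
    rintro x y ⟨hx, hx'⟩ ⟨hy, hy'⟩
    exact ⟨(eO Γ' O).add_mem' hx hy, fun τ hτ => by rw [mul_add, hx' τ hτ, hy' τ hτ]⟩
  smul_mem' := by
    rintro r x ⟨hx, hx'⟩
    exact ⟨(eO Γ' O).smul_mem' r hx, fun τ hτ => by rw [mul_smul_comm, hx' τ hτ]⟩
  left_mem' := by
    rintro _ x ⟨⟨y, hy, rfl⟩, hy'⟩ ⟨hx, hx'⟩
    refine ⟨?_, fun τ hτ => by rw [← mul_assoc, hy' τ hτ]⟩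
    rw [mul_assoc, trivIdem_mul Γ' hx']
    exact (eO Γ' O).mul_mem' hy hx
  right_mem' := by
    rintro x c ⟨hx, hx'⟩ hc
    exact ⟨(eO Γ' O).mul_mem' hx hc, fun τ hτ => by rw [← mul_assoc, hx' τ hτ]⟩
  one_left' := by
    rintro x ⟨hx, hx'⟩
    change augIdem Γ' * trivIdem Γ' * x = x
    rw [mul_assoc, trivIdem_mul Γ' hx']
    exact (eO Γ' O).one_mul' hx
  one_right' hx := (eO Γ' O).mul_one' hx.1

/-- The inclusion of `^{Γ'}(e_{Γ/Γ'} O)` in `e_{Γ/Γ'} O`. -/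
def leftInv.incl (x : (leftInv Γ' O).Elt) : (eO Γ' O).Elt := ⟨x.1, x.2.1⟩

/-- The `(e_{Γ/Γ'} O, o)`-bimodule `e_{Γ/Γ'} O e₁'`. -/
def rightProj : SubBimodule (eO Γ' O) (heckeOrder Γ' O) where
  carrier := {a | ∃ x ∈ (eO Γ' O).carrier, a = x * trivIdem Γ'}
  zero_mem' := ⟨0, (eO Γ' O).zero_mem', by simp⟩
  add_mem' := by
    rintro _ _ ⟨x, hx, rfl⟩ ⟨y, hy, rfl⟩
    exact ⟨x + y, (eO Γ' O).add_mem' hx hy, (add_mul _ _ _).symm⟩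
  smul_mem' := by
    rintro r _ ⟨x, hx, rfl⟩
    exact ⟨r • x, (eO Γ' O).smul_mem' r hx, (smul_mul_assoc _ _ _).symm⟩
  left_mem' := by
    rintro b _ hb ⟨x, hx, rfl⟩
    exact ⟨b * x, (eO Γ' O).mul_mem' hb hx, (mul_assoc _ _ _).symm⟩
  right_mem' := by
    rintro _ _ ⟨x, hx, rfl⟩ ⟨⟨y, hy, rfl⟩, hy'⟩
    exact ⟨x * y, (eO Γ' O).mul_mem' hx hy, by
      rw [mul_assoc, trivIdem_mul Γ' hy', mul_assoc]⟩
  one_left' := by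
    rintro _ ⟨x, hx, rfl⟩
    rw [← mul_assoc]
    congr 1
    exact (eO Γ' O).one_mul' hx
  one_right' := by
    rintro _ ⟨x, hx, rfl⟩
    change x * trivIdem Γ' * (augIdem Γ' * trivIdem Γ') = _
    rw [← mul_assoc, ← (augIdem_spec Γ').central, ← mul_assoc, mul_assoc, trivIdem_idem]
    congr 1
    exact (eO Γ' O).one_mul' hx

variable {O}

/-- The image `e_{Γ/Γ'} γ` of `γ ∈ Γ` in `e_{Γ/Γ'} O`, through which `Γ` acts on
`e_{Γ/Γ'} O`-modules. -/
def groupElt (hO : groupRing R Γ ≤ Subalgebra.toSubmodule O) (γ : Γ) : (eO Γ' O).Elt :=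
  ⟨augIdem Γ' * MonoidAlgebra.of ℚ Γ γ, _, hO (Submodule.subset_span ⟨γ, rfl⟩), rfl⟩

/-- The subgroup `^{Γ'}G` of `Γ'`-invariants of an `e_{Γ/Γ'} O`-module `G`. -/
def invariants (hO : groupRing R Γ ≤ Subalgebra.toSubmodule O) (G : Type*) [AddCommGroup G]
    [Module (eO Γ' O).Elt G] : AddSubgroup G where
  carrier := {g | ∀ τ ∈ Γ', groupElt Γ' hO τ • g = g}
  zero_mem' τ _ := smul_zero _
  add_mem' {x y} hx hy τ hτ := by rw [smul_add, hx τ hτ, hy τ hτ]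
  neg_mem' {x} hx τ hτ := by rw [smul_neg, hx τ hτ]

end Rings

end HeckeModel

end

noncomputable section

/-! Write e = e_{Γ/Γ'}, ε = e e₁', Λ = eO, P = Λe₁' and L = ^{Γ'}Λ. Multiplication in ℚ[Γ] gives PL
⊆ Λ and LP ⊆ o, and associativity makes this a Morita context. Everything therefore reduces to two
memberships, e ∈ PL and ε ∈ LP (`augIdem_mem_rightProj_mul_leftInv`,
`augIdem_mul_trivIdem_mem_leftInv_mul_rightProj`).

Both follow from one criterion for a maximal order with identity u
(`IsMaximalOrder.one_mem_of_forall_mul_mem`). Let I be a two-sided ideal containing a nonzero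
multiple of u, such that Ia inside the order forces Ia ⊆ I. Then I is the whole order. No
invertibility of ideals is invoked: maximality enters only because the right order of a two-sided
ideal containing some nu is again an order. The rest is ideal theory in the Artinian quotient by n.

Goodness of the primes gives Λ = eℤ_S[Γ], a maximal order whose elements have coefficients in ℤ_S.
Rationally, e lies in the two-sided ideal generated by ε, because the permutation module is
generated by a vector that e₁' fixes. So PL contains a multiple of e, and the criterion gives e ∈
PL. For LP, o must first be shown maximal: an order o' ⊇ o produces the order Po'L ⊇ Λ, hence Po'L =
Λ, and reflexivity of P brings o' back into o.

For invariants, integrality of coefficients makes (σe₁')g = σg well defined even if G has torsion.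
The map x ⊗ g ↦ xg is then bijective by the Morita argument, since ε ∈ LP. -/

/-! ### Two-sided ideals modulo a central element with Artinian quotient. -/

theorem exists_twoSided_annihilator_sup_eq_top {B : Type*} [Ring B] [IsSemisimpleRing B]
    (I : Ideal B) [I.IsTwoSided] :
    ∃ K : Ideal B, K.IsTwoSided ∧ I ⊔ K = ⊤ ∧ ∀ x ∈ I, ∀ y ∈ K, x * y = 0 := by
  obtain ⟨C, hC⟩ := exists_isCompl I
  let K : Ideal B :=
    { carrier := {y | ∀ x ∈ I, x * y = 0}
      zero_mem' := fun x _ => mul_zero x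
      add_mem' := fun {a b} ha hb x hx => by rw [mul_add, ha x hx, hb x hx, add_zero]
      smul_mem' := fun c y hy x hx => by
        rw [smul_eq_mul, ← mul_assoc]
        exact hy _ (I.mul_mem_right c hx) }
  refine ⟨K, ⟨fun b hy x hx => ?_⟩, ?_, fun x hx y hy => hy x hx⟩
  · rw [← mul_assoc, hy x hx, zero_mul]
  · rw [eq_top_iff, ← hC.sup_eq_top]
    refine sup_le_sup_left (fun c hc x hx => ?_) I
    -- For a left ideal C complementary to I, the product IC lies in I ∩ C = 0, so C is contained in
    -- the right annihilator of I.
    exact (Submodule.disjoint_def.1 hC.disjoint) _ (I.mul_mem_right c hx) (C.mul_mem_left x hc)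

/-- Modulo the Jacobson radical the ring is semisimple, and there I has a comaximal right
annihilator. Its preimage K satisfies IK ⊆ rad, and the radical is nilpotent. -/
theorem exists_twoSided_sup_eq_top_mul_pow_eq_bot {B : Type*} [Ring B] [IsSemiprimaryRing B]
    (I : Ideal B) [I.IsTwoSided] :
    ∃ K : Ideal B, K.IsTwoSided ∧ I ⊔ K = ⊤ ∧ ∃ m : ℕ, (I * K) ^ m = ⊥ := by
  let π := Ideal.Quotient.mk (Ring.jacobson B)
  have hπ : Function.Surjective π := Ideal.Quotient.mk_surjective
  have h2 : (I.map π).IsTwoSided := inferInstance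
  obtain ⟨K, hK, hsup, hmul⟩ := exists_twoSided_annihilator_sup_eq_top (I.map π)
  refine ⟨K.comap π, inferInstance, ?_, ?_⟩
  · rw [Ideal.eq_top_iff_one] at hsup ⊢
    obtain ⟨a, ha, b, hb, hab⟩ := Submodule.mem_sup.1 hsup
    obtain ⟨i, hi, rfl⟩ := (Ideal.mem_map_iff_of_surjective π hπ).1 ha
    refine Submodule.mem_sup.2 ⟨i, hi, 1 - i, ?_, by abel⟩
    rw [Ideal.mem_comap, map_sub, map_one, ← hab]
    simpa using hb
  · obtain ⟨m, hm⟩ := IsSemiprimaryRing.isNilpotent (R := B)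
    refine ⟨m, eq_bot_iff.2 ?_⟩
    have hle : I * K.comap π ≤ Ring.jacobson B := by
      rw [Ideal.mul_le]
      intro r hr s hs
      rw [← Ideal.Quotient.eq_zero_iff_mem, map_mul]
      exact hmul _ (Ideal.mem_map_of_mem π hr) _ hs
    exact (Ideal.pow_right_mono hle m).trans hm.le

/-- The hypotheses are free of denominators: with a = b/n, `horder` reads "Ka ⊆ K implies a ∈ Λ",
and `hI` reads "Ia ⊆ Λ implies a ∈ Λ". Choose K comaximal with I and (IK)^m ⊆ nΛ. The two hypotheses
allow the factors I to be deleted from this word at the cost of extra factors K, so a power of K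
lies in nΛ ⊆ I. Comaximality then forces I = Λ. -/
theorem Ideal.eq_top_of_isArtinianRing_quotient {Λ : Type*} [Ring Λ] (n : Λ)
    (hn : ∀ x, n * x = x * n) [(Ideal.span {n}).IsTwoSided]
    [IsArtinianRing (Λ ⧸ Ideal.span {n})] (I : Ideal Λ) [I.IsTwoSided] (hnI : n ∈ I)
    (horder : ∀ K : Ideal Λ, K.IsTwoSided → n ∈ K → ∀ b,
      (∀ k ∈ K, ∃ k' ∈ K, k * b = n * k') → b ∈ Ideal.span {n})
    (hI : ∀ b, (∀ x ∈ I, x * b ∈ Ideal.span {n}) → b ∈ Ideal.span {n}) : I = ⊤ := by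
  let π := Ideal.Quotient.mk (Ideal.span {n})
  have hπ : Function.Surjective π := Ideal.Quotient.mk_surjective
  have h2 : (I.map π).IsTwoSided := inferInstance
  obtain ⟨K', hK', hsup, m, hm⟩ := exists_twoSided_sup_eq_top_mul_pow_eq_bot (I.map π)
  set K := K'.comap π with hKdef
  have hK : K.IsTwoSided := inferInstance
  have hπn : π n = 0 := Ideal.Quotient.eq_zero_iff_mem.2 (Ideal.mem_span_singleton_self n)
  have hnK : n ∈ K := by simp [hKdef, Ideal.mem_comap, hπn]
  have hsupK : I ⊔ K = ⊤ := by
    rw [Ideal.eq_top_iff_one] at hsup ⊢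
    obtain ⟨a, ha, b, hb, hab⟩ := Submodule.mem_sup.1 hsup
    obtain ⟨i, hi, rfl⟩ := (Ideal.mem_map_iff_of_surjective π hπ).1 ha
    refine Submodule.mem_sup.2 ⟨i, hi, 1 - i, ?_, by abel⟩
    rw [Ideal.mem_comap, map_sub, map_one, ← hab]
    simpa using hb
  have hpow : ∀ j : ℕ, ∀ x ∈ (I * K) ^ j, π x ∈ (I.map π * K') ^ j := by
    intro j
    induction j with
    | zero => intro x _; rw [Submodule.pow_zero, Ideal.one_eq_top]; exact Submodule.mem_top
    | succ j ih =>
      suffices (I * K) ^ (j + 1) ≤ ((I.map π * K') ^ (j + 1)).comap π from fun x hx => this hx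
      rw [Ideal.IsTwoSided.pow_succ, Ideal.mul_le]
      intro r hr s hs
      rw [Ideal.mem_comap, map_mul, Ideal.IsTwoSided.pow_succ]
      refine Ideal.mul_mem_mul ?_ (ih s hs)
      suffices I * K ≤ (I.map π * K').comap π from this hr
      rw [Ideal.mul_le]
      intro r hr s hs
      rw [Ideal.mem_comap, map_mul]
      exact Ideal.mul_mem_mul (Ideal.mem_map_of_mem π hr) hs
  have hstart : (I * K) ^ m ≤ Ideal.span {n} := by
    intro x hx
    have := hpow m x hx
    rw [hm] at this
    exact Ideal.Quotient.eq_zero_iff_mem.1 this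
  -- Each of the j factors I is traded for one more factor K on the right.
  have hword : ∀ j b : ℕ, K * ((I * K) ^ j * K ^ b) ≤ Ideal.span {n} →
      K * K ^ (b + j) ≤ Ideal.span {n} := by
    intro j
    induction j with
    | zero =>
      intro b h
      rw [Submodule.pow_zero, Submodule.one_mul] at h
      simpa using h
    | succ j ih =>
      intro b h
      rw [show b + (j + 1) = b + 1 + j by ring]
      refine ih (b + 1) ?_
      have h' : K * (I * (K * ((I * K) ^ j * K ^ b))) ≤ Ideal.span {n} := by
        refine le_trans (le_of_eq ?_) h
        rw [Ideal.IsTwoSided.pow_succ]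
        simp only [mul_assoc]
      rw [Ideal.IsTwoSided.pow_add, Submodule.pow_one, ← mul_assoc ((I * K) ^ j),
        ← mul_assoc K, Ideal.mul_le]
      intro c hc k hk
      -- To get ck ∈ nΛ it suffices that xck ∈ nΛ for x ∈ I, and for this that k₀xck ∈ nK for k₀ ∈
      -- K. The hypothesis gives k₀xc = yn, so k₀xck = n(yk) with yk ∈ K; this is where the extra
      -- right factor k is needed.
      refine hI _ fun x hx => ?_
      refine horder K hK hnK _ fun k₀ hk₀ => ?_
      obtain ⟨y, hy⟩ := Ideal.mem_span_singleton'.1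
        (h' (Ideal.mul_mem_mul hk₀ (Ideal.mul_mem_mul hx hc)))
      refine ⟨y * k, K.mul_mem_left y hk, ?_⟩
      rw [← mul_assoc x, ← mul_assoc k₀, ← hy, ← mul_assoc, hn]
  have hfin : K * K ^ m ≤ I := by
    have := hword m 0 (by
      rw [Submodule.pow_zero, Ideal.IsTwoSided.mul_one]
      exact Ideal.mul_le_right.trans hstart)
    rw [zero_add] at this
    exact this.trans ((Ideal.span_singleton_le_iff_mem I).2 hnI)
  rw [← Ideal.IsTwoSided.pow_succ] at hfin
  rw [← Ideal.sup_pow_eq_top (n := m + 1) hsupK, left_eq_sup]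
  exact hfin

/-! ### Subrings of ℚ and finite algebras over them. -/

/-- By Bézout, a reduced fraction x in R has 1/den(x) ∈ R. Hence every ideal is generated by the
integers it contains, and these form a principal ideal of ℤ. -/
theorem Subring.isPrincipalIdealRing_of_rat (R : Subring ℚ) : IsPrincipalIdealRing R := by
  have hden : ∀ x : R, ((x : ℚ).den : ℚ)⁻¹ ∈ R := by
    intro x
    have hcop : IsCoprime ((x : ℚ).num) ((x : ℚ).den : ℤ) :=
      Int.isCoprime_iff_gcd_eq_one.2 (by simpa [Int.gcd] using (x : ℚ).reduced)
    obtain ⟨a, b, hab⟩ := hcop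
    have hd : ((x : ℚ).den : ℚ) ≠ 0 := by exact_mod_cast (x : ℚ).den_ne_zero
    have hx : (((x : ℚ).den : ℚ))⁻¹ = a * (x : ℚ) + b := by
      have h : (a : ℚ) * (x : ℚ).num + b * (x : ℚ).den = 1 := by exact_mod_cast hab
      have h3 : (x : ℚ) * (x : ℚ).den = (x : ℚ).num := Rat.mul_den_eq_num _
      field_simp
      rw [← h, ← h3]
      ring
    rw [hx]
    exact R.add_mem (R.mul_mem (intCast_mem R a) x.2) (intCast_mem R b)
  refine ⟨fun I => ?_⟩
  obtain ⟨d, hd⟩ := (IsPrincipalIdealRing.principal (I.comap (Int.castRingHom R))).principal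
  refine ⟨(d : R), le_antisymm (fun x hx => ?_) ?_⟩
  · have hxn : (x : ℚ).num ∈ I.comap (Int.castRingHom R) := by
      rw [Ideal.mem_comap]
      have h : (Int.castRingHom R (x : ℚ).num) = ((x : ℚ).den : R) * x := by
        apply Subtype.ext
        push_cast
        simp [Rat.den_mul_eq_num]
      rw [h]
      exact I.mul_mem_left _ hx
    rw [hd] at hxn
    obtain ⟨c, hc⟩ := Submodule.mem_span_singleton.1 hxn
    refine Submodule.mem_span_singleton.2 ⟨⟨_, hden x⟩ * (c : R), Subtype.ext ?_⟩
    have hc' : (c : ℚ) * d = (x : ℚ).num := by exact_mod_cast hc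
    simp only [smul_eq_mul, Subring.coe_mul, Subring.coe_intCast]
    rw [mul_assoc, hc', ← Rat.den_mul_eq_num (x : ℚ), ← mul_assoc, inv_mul_cancel₀, one_mul]
    exact_mod_cast (x : ℚ).den_ne_zero
  · rw [Submodule.span_singleton_le_iff_mem]
    have : d ∈ I.comap (Int.castRingHom R) := hd ▸ Submodule.mem_span_singleton_self d
    simpa using this

theorem IsPrincipalIdealRing.isArtinianRing_quotient_span_singleton {R : Type*} [CommRing R]
    [IsDomain R] [IsPrincipalIdealRing R] {x : R} (hx : x ≠ 0) :
    IsArtinianRing (R ⧸ Ideal.span {x}) := by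
  have : Ring.KrullDimLE 0 (R ⧸ Ideal.span {x}) := Ring.krullDimLE_zero_iff.mpr fun J hJ => by
    have h1 : (J.comap (Ideal.Quotient.mk (Ideal.span {x}))).IsPrime := hJ.comap _
    have h2 : (J.comap (Ideal.Quotient.mk (Ideal.span {x}))) ≠ ⊥ := fun h => hx (by
      have : x ∈ J.comap (Ideal.Quotient.mk (Ideal.span {x})) := by
        rw [Ideal.mem_comap, Ideal.Quotient.eq_zero_iff_mem.2 (Ideal.mem_span_singleton_self x)]
        exact J.zero_mem
      rwa [h, Ideal.mem_bot] at this)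
    have := IsPrime.to_maximal_ideal h2
    rw [← Ideal.map_comap_of_surjective _ Ideal.Quotient.mk_surjective J]
    exact (Ideal.map_eq_top_or_isMaximal_of_surjective _ Ideal.Quotient.mk_surjective
      this).resolve_left fun h => hJ.ne_top (by
        rw [← h, Ideal.map_comap_of_surjective _ Ideal.Quotient.mk_surjective J])
  exact IsNoetherianRing.isArtinianRing_of_krullDimLE_zero

/-- The quotient is a finite module over the Artinian ring R/n, so it is Artinian over R and a
fortiori over itself. -/
theorem isArtinianRing_quotient_span_natCast (R : Subring ℚ) {Λ : Type*} [Ring Λ] [Algebra R Λ]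
    [Module.Finite R Λ] {n : ℕ} (hn : n ≠ 0) [(Ideal.span {(n : Λ)}).IsTwoSided] :
    IsArtinianRing (Λ ⧸ Ideal.span {(n : Λ)}) := by
  have := R.isPrincipalIdealRing_of_rat
  have hn' : (n : R) ≠ 0 := by exact_mod_cast hn
  have := IsPrincipalIdealRing.isArtinianRing_quotient_span_singleton hn'
  let B := Λ ⧸ Ideal.span {(n : Λ)}
  have htors : Module.IsTorsionBySet R B (Ideal.span {(n : R)} : Set R) := by
    rw [Module.isTorsionBySet_span_singleton_iff]
    intro b
    obtain ⟨x, rfl⟩ := Ideal.Quotient.mk_surjective b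
    have : (n : R) • (Ideal.Quotient.mk (Ideal.span {(n : Λ)}) x)
        = Ideal.Quotient.mk (Ideal.span {(n : Λ)}) (x * n) := by
      rw [Nat.cast_smul_eq_nsmul, nsmul_eq_mul, ← Nat.cast_comm, map_mul, map_natCast]
    rw [this, Ideal.Quotient.eq_zero_iff_mem]
    exact Ideal.mul_mem_left _ _ (Ideal.mem_span_singleton_self _)
  let _ : Module (R ⧸ Ideal.span {(n : R)}) B := htors.module
  have : IsScalarTower R (R ⧸ Ideal.span {(n : R)}) B := htors.isScalarTower
  have h1 : Module.Finite (R ⧸ Ideal.span {(n : R)}) B :=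
    Module.Finite.of_restrictScalars_finite R _ _
  have h2 : IsArtinian (R ⧸ Ideal.span {(n : R)}) B := inferInstance
  have h3 : IsArtinian R B := isArtinian_of_surjective_algebraMap (S := R)
    (R := R ⧸ Ideal.span {(n : R)}) Ideal.Quotient.mk_surjective
  exact isArtinian_of_tower R h3

/-! ### A criterion for an ideal of a maximal order to be everything. -/

namespace HeckeModel

theorem submodule_fg_of_le {R : Subring ℚ} {M : Type*} [AddCommGroup M] [Module R M]
    {N N' : Submodule R M} (hN : N.FG) (h : N' ≤ N) : N'.FG := by
  have := R.isPrincipalIdealRing_of_rat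
  exact isNoetherian_submodule.1 (isNoetherian_of_fg_of_noetherian N hN) N' h

/-- The ring underlying an order in `u A u`. -/
def IsOrder.toSubRingWithOne {R : Subring ℚ} {A : Type*} [Ring A] [Algebra ℚ A] {u : A}
    {L : Submodule R A} (hL : IsOrder R u L) : SubRingWithOne R A where
  toSubmodule := L
  one' := u
  one_mem' := hL.one_mem
  mul_mem' hx hy := hL.mul_mem _ hx _ hy
  one_mul' hx := hL.one_mul _ hx
  mul_one' hx := hL.mul_one _ hx

section

variable {R A : Type*} [CommRing R] [Ring A] [Algebra R A] (B : SubRingWithOne R A)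

theorem SubRingWithOne.coe_add (x y : B.Elt) : (x + y).1 = x.1 + y.1 := rfl

theorem SubRingWithOne.coe_natCast (n : ℕ) : (n : B.Elt).1 = n • B.one' := by
  rw [← nsmul_one]
  exact map_nsmul B.toSubmodule.subtype n (⟨B.one', B.one_mem'⟩ : B.toSubmodule)

end

/-- If Ia ⊆ L, then Ia ⊆ I by `h`, so a lies in the right order of I, which is L by maximality. Thus
I has no dual beyond L, and the ideal-theoretic lemma applies to L modulo n. -/
theorem IsMaximalOrder.one_mem_of_forall_mul_mem {R : Subring ℚ} {A : Type*} [Ring A] [Algebra ℚ A]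
    {u : A} {L : Submodule R A} (hL : IsMaximalOrder R u L) {I : Submodule R A} (hIL : I ≤ L)
    (hl : ∀ x ∈ L, ∀ y ∈ I, x * y ∈ I) (hr : ∀ y ∈ I, ∀ x ∈ L, y * x ∈ I) {n : ℕ} (hn : n ≠ 0)
    (hnI : n • u ∈ I)
    (h : ∀ a, u * a = a → a * u = a → (∀ x ∈ I, x * a ∈ L) → ∀ x ∈ I, x * a ∈ I) :
    u ∈ I := by
  have hn' : (n : ℚ) ≠ 0 := by exact_mod_cast hn
  let B := hL.1.toSubRingWithOne
  have hBn : ((n : B.Elt)).1 = n • u := B.coe_natCast n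
  have hfin : Module.Finite R B.Elt := Module.Finite.iff_fg.2 hL.1.fg
  have h2 : (Ideal.span {(n : B.Elt)}).IsTwoSided := ⟨fun {x} y hx => by
    obtain ⟨c, rfl⟩ := Ideal.mem_span_singleton'.1 hx
    rw [mul_assoc, (Nat.cast_commute n y).eq, ← mul_assoc]
    exact Ideal.mul_mem_left _ _ (Ideal.mem_span_singleton_self _)⟩
  have hart := isArtinianRing_quotient_span_natCast R (Λ := B.Elt) hn
  have hmemL : ∀ b : B.Elt, (n : ℚ)⁻¹ • b.1 ∈ L → b ∈ Ideal.span {(n : B.Elt)} := by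
    intro b hb
    refine Ideal.mem_span_singleton'.2 ⟨⟨_, hb⟩, Subtype.ext ?_⟩
    change (n : ℚ)⁻¹ • b.1 * (n : B.Elt).1 = b.1
    rw [hBn, mul_smul_comm, smul_mul_assoc, hL.1.mul_one _ b.2,
      ← Nat.cast_smul_eq_nsmul ℚ, smul_smul,
      mul_inv_cancel₀ hn', one_smul]
  let J : Ideal B.Elt :=
    { carrier := {x | x.1 ∈ I}
      zero_mem' := I.zero_mem
      add_mem' := fun hx hy => I.add_mem hx hy
      smul_mem' := fun c x hx => hl _ c.2 _ hx }
  have hJ : J.IsTwoSided := ⟨fun {x} y hx => hr _ hx _ y.2⟩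
  have hone : ∀ b : B.Elt, ∀ q : ℚ, u * (q • b.1) = q • b.1 ∧ (q • b.1) * u = q • b.1 :=
    fun b q => ⟨by rw [mul_smul_comm, hL.1.one_mul _ b.2],
      by rw [smul_mul_assoc, hL.1.mul_one _ b.2]⟩
  have horder : ∀ K : Ideal B.Elt, K.IsTwoSided → (n : B.Elt) ∈ K → ∀ b,
      (∀ k ∈ K, ∃ k' ∈ K, k * b = n * k') → b ∈ Ideal.span {(n : B.Elt)} := by
    intro K hK hnK b hb
    -- The right order of K inside uAu.
    let L' : Submodule R A :=
      { carrier := {a | u * a = a ∧ a * u = a ∧ ∀ k ∈ K, ∃ k' ∈ K, k.1 * a = k'.1}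
        zero_mem' := ⟨by simp, by simp, fun k _ => ⟨0, K.zero_mem, by rw [mul_zero]; rfl⟩⟩
        add_mem' := by
          rintro a a' ⟨h1, h2, h3⟩ ⟨h1', h2', h3'⟩
          refine ⟨by rw [mul_add, h1, h1'], by rw [add_mul, h2, h2'], fun k hk => ?_⟩
          obtain ⟨x, hx, hxa⟩ := h3 k hk
          obtain ⟨y, hy, hya⟩ := h3' k hk
          exact ⟨x + y, K.add_mem hx hy, by rw [mul_add, hxa, hya, B.coe_add]⟩
        smul_mem' := by
          rintro r a ⟨h1, h2, h3⟩
          refine ⟨by rw [mul_smul_comm, h1], by rw [smul_mul_assoc, h2], fun k hk => ?_⟩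
          obtain ⟨x, hx, hxa⟩ := h3 k hk
          refine ⟨(r • (1 : B.Elt)) * x, K.mul_mem_left _ hx, ?_⟩
          rw [mul_smul_comm, hxa, smul_mul_assoc, one_mul]
          rfl }
    have hLL' : L ≤ L' := fun a ha => ⟨hL.1.one_mul a ha, hL.1.mul_one a ha,
      fun k hk => ⟨k * ⟨a, ha⟩, K.mul_mem_right _ hk, rfl⟩⟩
    have hL' : IsOrder R u L' :=
      { one_mem := hLL' hL.1.one_mem
        mul_mem := by
          rintro a ⟨h1, h2, h3⟩ a' ⟨h1', h2', h3'⟩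
          refine ⟨by rw [← mul_assoc, h1], by rw [mul_assoc, h2'], fun k hk => ?_⟩
          obtain ⟨x, hx, hxa⟩ := h3 k hk
          obtain ⟨y, hy, hya⟩ := h3' x hx
          exact ⟨y, hy, by rw [← mul_assoc, hxa, hya]⟩
        one_mul := fun a ha => ha.1
        mul_one := fun a ha => ha.2.1
        fg := by
          -- Since nu ∈ K, each a in the right order has na ∈ K ⊆ L. So the right order sits in
          -- n⁻¹L, which is finitely generated over a Noetherian ring.
          refine submodule_fg_of_le (hL.1.fg.map (LinearMap.mulLeft R ((n : ℚ)⁻¹ • u))) ?_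
          rintro a ⟨h1, h2, h3⟩
          obtain ⟨x, hx, hxa⟩ := h3 _ hnK
          rw [hBn, smul_mul_assoc, h1] at hxa
          refine ⟨x.1, x.2, ?_⟩
          rw [LinearMap.mulLeft_apply, ← hxa, smul_mul_assoc, mul_smul_comm, h1,
            ← Nat.cast_smul_eq_nsmul ℚ, smul_smul, inv_mul_cancel₀ hn', one_smul]
        span := fun x => Submodule.span_mono hLL' (hL.1.span x) }
    have hmem : (n : ℚ)⁻¹ • b.1 ∈ L' := by
      refine ⟨(hone b _).1, (hone b _).2, fun k hk => ?_⟩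
      obtain ⟨k', hk', hkb⟩ := hb k hk
      refine ⟨k', hk', ?_⟩
      have : k.1 * b.1 = n • k'.1 := by
        have : k.1 * b.1 = (n : B.Elt).1 * k'.1 := congrArg Subtype.val hkb
        rw [hBn, smul_mul_assoc] at this
        rw [this, hL.1.one_mul _ k'.2]
      rw [mul_smul_comm, this, ← Nat.cast_smul_eq_nsmul ℚ, smul_smul, inv_mul_cancel₀ hn',
        one_smul]
    rw [hL.2 L' hL' hLL'] at hmem
    exact hmemL b hmem
  have hnJ : (n : B.Elt) ∈ J := by change _ ∈ I; rwa [hBn]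
  have key := Ideal.eq_top_of_isArtinianRing_quotient (n : B.Elt)
    (fun x => (Nat.cast_commute n x).eq) J hnJ horder fun b hb => horder J hJ hnJ b fun x hx => ?_
  · have : (1 : B.Elt) ∈ J := key ▸ Submodule.mem_top
    exact this
  -- Apply `h` to a = b/n.
  · have hxb : ∀ x ∈ I, x * ((n : ℚ)⁻¹ • b.1) ∈ L := fun x hx => by
      obtain ⟨c, hc⟩ := Ideal.mem_span_singleton'.1 (hb ⟨x, hIL hx⟩ hx)
      have hc' : n • c.1 = x * b.1 := by
        have : c.1 * (n : B.Elt).1 = x * b.1 := congrArg Subtype.val hc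
        rw [hBn, mul_smul_comm] at this
        rw [← this, hL.1.mul_one _ c.2]
      rw [mul_smul_comm, ← hc', ← Nat.cast_smul_eq_nsmul ℚ, smul_smul, inv_mul_cancel₀ hn',
        one_smul]
      exact c.2
    have hxI := h _ (hone b _).1 (hone b _).2 hxb x.1 hx
    refine ⟨⟨_, hIL hxI⟩, hxI, Subtype.ext ?_⟩
    change x.1 * b.1 = (n : B.Elt).1 * (x.1 * ((n : ℚ)⁻¹ • b.1))
    rw [hBn, smul_mul_assoc, hL.1.one_mul _ (hIL hxI), mul_smul_comm,
      ← Nat.cast_smul_eq_nsmul ℚ, smul_smul, mul_inv_cancel₀ hn', one_smul]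

end HeckeModel

/-! ### Coefficients in the group ring and cosets of Γ'. -/

namespace HeckeModel

section GroupRing

variable {Γ : Type u} [Group Γ]

theorem sum_coeff_smul_of [Fintype Γ] (x : MonoidAlgebra ℚ Γ) :
    ∑ γ, x.coeff γ • MonoidAlgebra.of ℚ Γ γ = x := by
  conv_rhs => rw [← MonoidAlgebra.sum_coeff_single x]
  rw [Finsupp.sum_fintype _ _ (by simp)]
  simp

theorem mem_groupRing_iff [Finite Γ] {R : Subring ℚ} {x : MonoidAlgebra ℚ Γ} :
    x ∈ groupRing R Γ ↔ ∀ γ, x.coeff γ ∈ R := by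
  classical
  have := Fintype.ofFinite Γ
  constructor
  · intro hx
    induction hx using Submodule.span_induction with
    | mem x hx =>
      obtain ⟨γ, rfl⟩ := hx
      intro δ
      rw [MonoidAlgebra.of_apply, MonoidAlgebra.coeff_single, Finsupp.single_apply]
      split_ifs
      exacts [R.one_mem, R.zero_mem]
    | zero => intro γ; exact R.zero_mem
    | add x y _ _ hx hy => intro γ; exact R.add_mem (hx γ) (hy γ)
    | smul r x _ hx => intro γ; exact R.mul_mem r.2 (hx γ)
  · intro h
    rw [← sum_coeff_smul_of x]
    exact Submodule.sum_mem _ fun γ _ =>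
      (groupRing R Γ).smul_mem ⟨_, h γ⟩ (Submodule.subset_span ⟨γ, rfl⟩)

theorem of_mem_groupRing (R : Subring ℚ) (γ : Γ) : MonoidAlgebra.of ℚ Γ γ ∈ groupRing R Γ :=
  Submodule.subset_span ⟨γ, rfl⟩

theorem trivIdem_mul_of [Finite Γ] (Γ' : Subgroup Γ) (τ : Γ') :
    trivIdem Γ' * MonoidAlgebra.of ℚ Γ (τ : Γ) = trivIdem Γ' := by
  have := Fintype.ofFinite Γ'
  rw [trivIdem, finsum_eq_sum_of_fintype, smul_mul_assoc, Finset.sum_mul]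
  congr 1
  refine Fintype.sum_equiv (Equiv.mulRight τ) _ _ fun σ => ?_
  simp [MonoidAlgebra.single_mul_single]

theorem card_smul_trivIdem [Finite Γ] (Γ' : Subgroup Γ) [Fintype Γ'] :
    Nat.card Γ' • trivIdem Γ' = ∑ τ : Γ', MonoidAlgebra.of ℚ Γ (τ : Γ) := by
  rw [trivIdem, finsum_eq_sum_of_fintype, ← Nat.cast_smul_eq_nsmul ℚ, smul_smul, mul_inv_cancel₀,
    one_smul]
  exact_mod_cast Nat.card_pos.ne'

theorem card_smul_trivIdem_mem [Finite Γ] (R : Subring ℚ) (Γ' : Subgroup Γ) :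
    Nat.card Γ' • trivIdem Γ' ∈ groupRing R Γ := by
  have := Fintype.ofFinite Γ'
  rw [card_smul_trivIdem]
  exact Submodule.sum_mem _ fun τ _ => of_mem_groupRing R _

theorem sum_eq_sum_quotient_sum {M : Type*} [AddCommMonoid M] [Fintype Γ] (Γ' : Subgroup Γ)
    [Fintype Γ'] [Fintype (Γ ⧸ Γ')] (f : Γ → M) :
    ∑ γ, f γ = ∑ q : Γ ⧸ Γ', ∑ τ : Γ', f (q.out * τ) := by
  rw [← Fintype.sum_prod_type' fun (q : Γ ⧸ Γ') (τ : Γ') => f (q.out * τ)]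
  refine (Function.Bijective.sum_comp (e := fun p : (Γ ⧸ Γ') × Γ' => p.1.out * (p.2 : Γ))
    ⟨?_, fun γ => ?_⟩ f).symm
  · rintro ⟨q, τ⟩ ⟨q', τ'⟩ h
    have hq : q = q' := by
      have h1 := congrArg (QuotientGroup.mk (s := Γ')) h
      simpa using h1
    subst hq
    simpa using h
  · obtain ⟨τ, hτ⟩ := QuotientGroup.mk_out_eq_mul Γ' γ
    exact ⟨(γ, τ⁻¹), by simp [hτ]⟩

/-- Right invariance makes the coefficients of x constant on cosets γΓ'. Keeping one representative
per coset, with coefficient multiplied by |Γ'|, gives z. -/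
theorem exists_eq_mul_trivIdem [Finite Γ] {R : Subring ℚ} (Γ' : Subgroup Γ)
    {x : MonoidAlgebra ℚ Γ} (hx : x * trivIdem Γ' = x) (hR : Nat.card Γ' • x ∈ groupRing R Γ) :
    ∃ z ∈ groupRing R Γ, x = z * trivIdem Γ' := by
  classical
  have := Fintype.ofFinite Γ
  have hc : ∀ (γ : Γ) (τ : Γ'), x.coeff (γ * τ) = x.coeff γ := by
    intro γ τ
    have h : x * MonoidAlgebra.of ℚ Γ (τ : Γ) = x := by
      rw [← hx, mul_assoc, trivIdem_mul_of]
    conv_lhs => rw [← h]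
    rw [MonoidAlgebra.of_apply, MonoidAlgebra.coeff_mul_single_apply]
    simp
  refine ⟨∑ q : Γ ⧸ Γ', (Nat.card Γ' • x).coeff q.out • MonoidAlgebra.of ℚ Γ q.out,
    Submodule.sum_mem _ fun q _ => (groupRing R Γ).smul_mem
      ⟨_, mem_groupRing_iff.1 hR q.out⟩ (of_mem_groupRing R _), ?_⟩
  conv_lhs => rw [← hx, ← sum_coeff_smul_of x]
  rw [sum_eq_sum_quotient_sum Γ', Finset.sum_mul, Finset.sum_mul]
  refine Finset.sum_congr rfl fun q _ => ?_
  rw [Finset.sum_mul]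
  have : ∀ τ : Γ', x.coeff (q.out * τ) • MonoidAlgebra.of ℚ Γ (q.out * τ) * trivIdem Γ' =
      x.coeff q.out • MonoidAlgebra.of ℚ Γ q.out * trivIdem Γ' := by
    intro τ
    rw [hc, map_mul, smul_mul_assoc, mul_assoc, of_mul_trivIdem, smul_mul_assoc]
  rw [Finset.sum_congr rfl fun τ _ => this τ, Finset.sum_const, Finset.card_univ,
    ← Nat.card_eq_fintype_card, MonoidAlgebra.coeff_smul, Finsupp.smul_apply, smul_assoc,
    smul_mul_assoc, smul_mul_assoc, smul_mul_assoc]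

/-- Up to the factor |Γ'|, the coefficient of x e₁' at γ is the sum of the coefficients of x over
γΓ'. -/
theorem sum_coeff_mul_eq_zero [Finite Γ] (Γ' : Subgroup Γ) [Fintype Γ']
    {x : MonoidAlgebra ℚ Γ} (hx : x * trivIdem Γ' = 0) (γ : Γ) :
    ∑ τ : Γ', x.coeff (γ * τ) = 0 := by
  have h : x * (Nat.card Γ' • trivIdem Γ') = 0 := by rw [mul_smul_comm, hx, smul_zero]
  rw [card_smul_trivIdem, Finset.mul_sum] at h
  have h2 := DFunLike.congr_fun (congrArg MonoidAlgebra.coeff h) γ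
  rw [MonoidAlgebra.coeff_sum, Finsupp.finsetSum_apply, MonoidAlgebra.coeff_zero,
    Finsupp.zero_apply] at h2
  rw [← h2]
  refine Fintype.sum_equiv (Equiv.inv Γ') _ _ fun τ => ?_
  rw [MonoidAlgebra.of_apply, MonoidAlgebra.coeff_mul_single_apply]
  simp

theorem mul_mem_groupRing [Finite Γ] {R : Subring ℚ} {x y : MonoidAlgebra ℚ Γ}
    (hx : x ∈ groupRing R Γ) (hy : y ∈ groupRing R Γ) : x * y ∈ groupRing R Γ := by
  have h : groupRing R Γ * groupRing R Γ ≤ groupRing R Γ := by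
    rw [groupRing, Submodule.span_mul_span, Submodule.span_le]
    rintro _ ⟨_, ⟨γ, rfl⟩, _, ⟨δ, rfl⟩, rfl⟩
    exact Submodule.subset_span ⟨γ * δ, map_mul _ _ _⟩
  exact h (Submodule.mul_mem_mul hx hy)

end GroupRing

/-! ### From good primes to the maximal order eℤ_S[Γ]. -/

section Good

variable {Γ : Type u} [Group Γ] [Finite Γ]

/-- This is ℤ_S = ⋂ ℤ_(p) over p ∈ S, coefficient by coefficient. -/
theorem mem_groupRing_zS {S : Set Nat.Primes} {x : MonoidAlgebra ℚ Γ}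
    (h : ∀ p ∈ S, x ∈ groupRing (zS {p}) Γ) : x ∈ groupRing (zS S) Γ :=
  mem_groupRing_iff.2 fun γ p hp => mem_groupRing_iff.1 (h p hp) γ p rfl

/-- Extension of scalars of an order to a larger subring of `ℚ`. -/
theorem IsOrder.span_of_le {R R' : Subring ℚ} (hRR' : R ≤ R') {A : Type*} [Ring A] [Algebra ℚ A]
    {u : A} {L : Submodule R A} (hL : IsOrder R u L) :
    IsOrder R' u (Submodule.span R' (L : Set A)) where
  one_mem := Submodule.subset_span hL.one_mem
  mul_mem x hx y hy := by
    have h : Submodule.span R' (L : Set A) * Submodule.span R' (L : Set A) ≤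
        Submodule.span R' (L : Set A) := by
      rw [Submodule.span_mul_span, Submodule.span_le]
      rintro _ ⟨a, ha, b, hb, rfl⟩
      exact Submodule.subset_span (hL.mul_mem a ha b hb)
    exact h (Submodule.mul_mem_mul hx hy)
  one_mul x hx := by
    induction hx using Submodule.span_induction with
    | mem x hx => exact hL.one_mul x hx
    | zero => exact mul_zero u
    | add x y _ _ hx hy => rw [mul_add, hx, hy]
    | smul r x _ hx => rw [mul_smul_comm, hx]
  mul_one x hx := by
    induction hx using Submodule.span_induction with
    | mem x hx => exact hL.mul_one x hx
    | zero => exact zero_mul u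
    | add x y _ _ hx hy => rw [add_mul, hx, hy]
    | smul r x _ hx => rw [smul_mul_assoc, hx]
  fg := by
    obtain ⟨t, ht⟩ := hL.fg
    refine ⟨t, le_antisymm (Submodule.span_mono ?_) (Submodule.span_le.2 ?_)⟩
    · rw [← ht]; exact Submodule.subset_span
    · intro x hx
      change x ∈ L at hx
      rw [← ht] at hx
      induction hx using Submodule.span_induction with
      | mem x hx => exact Submodule.subset_span hx
      | zero => exact Submodule.zero_mem _
      | add x y _ _ hx hy => exact Submodule.add_mem _ hx hy
      | smul r x _ hx => exact Submodule.smul_mem _ (⟨r.1, hRR' r.2⟩ : R') hx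
  span x := Submodule.span_mono Submodule.subset_span (hL.span x)

/-- Maximality is checked locally: after extension of scalars to ℤ_(p), the order contains the
maximal order eℤ_(p)[Γ] and so equals it. Elements of L therefore have p-integral coefficients for
every p ∈ S. -/
theorem le_map_groupRing_of_isGoodPrime {S : Set Nat.Primes} {e : MonoidAlgebra ℚ Γ}
    (hgood : ∀ p ∈ S, IsGoodPrime p e) {L : Submodule (zS S) (MonoidAlgebra ℚ Γ)}
    (hL : IsOrder (zS S) e L) (h : (groupRing (zS S) Γ).map (LinearMap.mulLeft (zS S) e) ≤ L) :
    L ≤ (groupRing (zS S) Γ).map (LinearMap.mulLeft (zS S) e) := by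
  intro x hx
  refine ⟨x, mem_groupRing_zS fun p hp => ?_, hL.one_mul x hx⟩
  have hle : zS S ≤ zS {p} := by
    rintro q hq _ rfl
    exact hq _ hp
  obtain ⟨he, hmax⟩ := hgood p hp
  have heq := hmax.2 _ (hL.span_of_le hle) (by
    rw [groupRing, Submodule.map_span, Submodule.span_le]
    rintro _ ⟨_, ⟨γ, rfl⟩, rfl⟩
    exact Submodule.subset_span (h ⟨_, of_mem_groupRing _ γ, rfl⟩))
  have hx' : x ∈ Submodule.span (zS {p}) (L : Set (MonoidAlgebra ℚ Γ)) :=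
    Submodule.subset_span hx
  rw [heq] at hx'
  obtain ⟨y, hy, rfl⟩ := hx'
  exact mul_mem_groupRing he hy

variable {R : Subring ℚ} (Γ' : Subgroup Γ) (O : Subalgebra R (MonoidAlgebra ℚ Γ))

theorem eO_toSubmodule :
    (eO Γ' O).toSubmodule =
      (Subalgebra.toSubmodule O).map (LinearMap.mulLeft R (augIdem Γ')) := by
  ext a
  exact ⟨fun ⟨x, hx, h⟩ => ⟨x, hx, h.symm⟩, fun ⟨x, hx, h⟩ => ⟨x, hx, h.symm⟩⟩

theorem isOrder_eO {O : Subalgebra R (MonoidAlgebra ℚ Γ)}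
    (hO : IsOrder R 1 (Subalgebra.toSubmodule O)) :
    IsOrder R (augIdem Γ') (eO Γ' O).toSubmodule where
  one_mem := (eO Γ' O).one_mem'
  mul_mem _ hx _ hy := (eO Γ' O).mul_mem' hx hy
  one_mul _ hx := (eO Γ' O).one_mul' hx
  mul_one _ hx := (eO Γ' O).mul_one' hx
  fg := by
    rw [eO_toSubmodule]
    exact hO.fg.map _
  span x := by
    have h1 := hO.span x
    rw [one_mul, mul_one] at h1
    rw [mul_assoc, ← (augIdem_spec Γ').central, ← mul_assoc, (augIdem_spec Γ').idem]
    induction h1 using Submodule.span_induction with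
    | mem x hx => exact Submodule.subset_span ⟨x, hx, rfl⟩
    | zero => rw [mul_zero]; exact Submodule.zero_mem _
    | add x y _ _ hx hy => rw [mul_add]; exact Submodule.add_mem _ hx hy
    | smul r x _ hx => rw [mul_smul_comm]; exact Submodule.smul_mem _ _ hx

variable {S : Set Nat.Primes} {O : Subalgebra (zS S) (MonoidAlgebra ℚ Γ)}

/-- Passing from ℤ_S[Γ] to O adds nothing after multiplication by e. This integrality is used for
the reflexivity of P and for the action on invariants. -/
theorem mem_eO_iff_of_isGoodPrime (hgood : ∀ p ∈ S, IsGoodPrime p (augIdem Γ'))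
    (hO : IsOrder (zS S) 1 (Subalgebra.toSubmodule O))
    (hΓ : groupRing (zS S) Γ ≤ Subalgebra.toSubmodule O) {x : MonoidAlgebra ℚ Γ} :
    x ∈ (eO Γ' O).toSubmodule ↔ x ∈ groupRing (zS S) Γ ∧ augIdem Γ' * x = x := by
  constructor
  · intro hx
    obtain ⟨y, hy, rfl⟩ := le_map_groupRing_of_isGoodPrime hgood (isOrder_eO Γ' hO) (by
      rw [eO_toSubmodule]; exact Submodule.map_mono hΓ) hx
    refine ⟨mul_mem_groupRing (mem_groupRing_zS fun p hp => (hgood p hp).1) hy, ?_⟩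
    rw [LinearMap.mulLeft_apply, ← mul_assoc, (augIdem_spec Γ').idem]
  · rintro ⟨hx, hex⟩
    exact ⟨x, hΓ hx, hex.symm⟩

theorem isMaximalOrder_eO (hgood : ∀ p ∈ S, IsGoodPrime p (augIdem Γ'))
    (hO : IsOrder (zS S) 1 (Subalgebra.toSubmodule O))
    (hΓ : groupRing (zS S) Γ ≤ Subalgebra.toSubmodule O) :
    IsMaximalOrder (zS S) (augIdem Γ') (eO Γ' O).toSubmodule := by
  have hle : (groupRing (zS S) Γ).map (LinearMap.mulLeft (zS S) (augIdem Γ')) ≤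
      (eO Γ' O).toSubmodule := by
    rw [eO_toSubmodule]
    exact Submodule.map_mono hΓ
  refine ⟨isOrder_eO Γ' hO, fun L hL hLe => le_antisymm ?_ hLe⟩
  exact (le_map_groupRing_of_isGoodPrime hgood hL (hle.trans hLe)).trans hle

end Good

end HeckeModel

/-! ### The ideal generated by e e₁', rationally and integrally. -/

/-- Let K be the right annihilator of I. Once I ∩ K = 0 is known, the I-component of 1 in I + K is a
two-sided identity of I, hence central. -/
theorem exists_central_one_of_isTwoSided {A : Type*} [Ring A] [IsSemisimpleRing A]
    (I : Ideal A) [I.IsTwoSided] : ∃ f ∈ I, (∀ x, f * x = x * f) ∧ ∀ x ∈ I, f * x = x := by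
  obtain ⟨K, hK, hsup, hIK⟩ := exists_twoSided_annihilator_sup_eq_top I
  have hN : ∀ x ∈ I ⊓ K, x = 0 := by
    intro x hx
    obtain ⟨C, hC⟩ := exists_isCompl (I ⊓ K)
    have h1 : (1 : A) ∈ (I ⊓ K) ⊔ C := hC.sup_eq_top ▸ Submodule.mem_top
    obtain ⟨g, hg, c, hc, hgc⟩ := Submodule.mem_sup.1 h1
    -- Here 1 = g + c with g ∈ I ∩ K, and xg = 0 because x ∈ I and g ∈ K. So x = xc lies in the
    -- complement C as well.
    have hxc : x * c = x := by
      conv_rhs => rw [← mul_one x, ← hgc, mul_add, hIK x hx.1 g hg.2, zero_add]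
    exact Submodule.disjoint_def.1 hC.disjoint x hx (hxc ▸ C.mul_mem_left x hc)
  obtain ⟨f, hf, k, hk, hfk⟩ := Submodule.mem_sup.1
    ((Ideal.eq_top_iff_one _).1 hsup)
  have hr : ∀ x ∈ I, x * f = x := fun x hx => by
    conv_rhs => rw [← mul_one x, ← hfk, mul_add, hIK x hx k hk, add_zero]
  have hl : ∀ x ∈ I, f * x = x := fun x hx => by
    conv_rhs => rw [← one_mul x, ← hfk, add_mul,
      hN (k * x) ⟨I.mul_mem_left k hx, K.mul_mem_right x hk⟩, add_zero]
  exact ⟨f, hf, fun x => by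
    rw [← hr _ (I.mul_mem_right x hf), mul_assoc, hl _ (I.mul_mem_left x hf)], hl⟩

namespace HeckeModel

variable {Γ : Type u} [Group Γ] [Finite Γ]

theorem asAlgebraHom_trivIdem (Γ' : Subgroup Γ) :
    (Representation.ofMulAction ℚ Γ (Γ ⧸ Γ')).asAlgebraHom (trivIdem Γ')
      (MonoidAlgebra.single ((1 : Γ) : Γ ⧸ Γ') 1) = MonoidAlgebra.single ((1 : Γ) : Γ ⧸ Γ') 1 := by
  have := Fintype.ofFinite Γ'
  rw [trivIdem, finsum_eq_sum_of_fintype, map_smul, map_sum, LinearMap.smul_apply,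
    LinearMap.sum_apply]
  have : ∀ τ : Γ', (Representation.ofMulAction ℚ Γ (Γ ⧸ Γ')).asAlgebraHom
      (MonoidAlgebra.of ℚ Γ (τ : Γ)) (MonoidAlgebra.single ((1 : Γ) : Γ ⧸ Γ') 1) =
        MonoidAlgebra.single ((1 : Γ) : Γ ⧸ Γ') 1 := by
    intro τ
    rw [Representation.asAlgebraHom_of, Representation.ofMulAction_single]
    congr 1
    change (((τ : Γ) * 1 : Γ) : Γ ⧸ Γ') = _
    rw [mul_one, QuotientGroup.eq]
    simp
  rw [Finset.sum_congr rfl fun τ _ => this τ, Finset.sum_const, Finset.card_univ,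
    ← Nat.card_eq_fintype_card, ← Nat.cast_smul_eq_nsmul ℚ, smul_smul, inv_mul_cancel₀, one_smul]
  exact_mod_cast Nat.card_pos.ne'

omit [Finite Γ] in
theorem exists_asAlgebraHom_single_eq (Γ' : Subgroup Γ) (w : MonoidAlgebra ℚ (Γ ⧸ Γ')) :
    ∃ x : MonoidAlgebra ℚ Γ, (Representation.ofMulAction ℚ Γ (Γ ⧸ Γ')).asAlgebraHom x
      (MonoidAlgebra.single ((1 : Γ) : Γ ⧸ Γ') 1) = w := by
  induction w using MonoidAlgebra.induction_linear with
  | zero => exact ⟨0, by simp⟩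
  | add v w hv hw =>
    obtain ⟨x, rfl⟩ := hv
    obtain ⟨y, rfl⟩ := hw
    exact ⟨x + y, by simp⟩
  | single q c =>
    refine ⟨c • MonoidAlgebra.of ℚ Γ q.out, ?_⟩
    rw [map_smul, LinearMap.smul_apply, Representation.asAlgebraHom_of,
      Representation.ofMulAction_single, MonoidAlgebra.smul_single, smul_eq_mul, mul_one]
    congr 1
    change ((q.out * 1 : Γ) : Γ ⧸ Γ') = q
    simp

/-- The idempotent `e_{Γ/Γ'}` lies in the two-sided ideal generated by `e_{Γ/Γ'} e₁'`. -/
theorem augIdem_mem_of_isTwoSided (Γ' : Subgroup Γ) (I : Ideal (MonoidAlgebra ℚ Γ)) [I.IsTwoSided]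
    (h : augIdem Γ' * trivIdem Γ' ∈ I) : augIdem Γ' ∈ I := by
  obtain ⟨f, hf, hcen, hone⟩ := exists_central_one_of_isTwoSided I
  -- The identity f of I is a central idempotent. If it acts trivially on the augmentation
  -- representation, minimality gives e = ef ∈ I.
  rw [← (augIdem_spec Γ').minimal f (hone f hf) hcen fun w hw => ?_]
  · exact I.mul_mem_left _ hf
  · obtain ⟨x, hx⟩ := exists_asAlgebraHom_single_eq Γ' w
    -- The trivial coset v generates the permutation module and is fixed by e₁', so w = xv yields w
    -- = ew = (x e e₁')v. As x e e₁' ∈ I, multiplication by f does not change it.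
    have h1 : (Representation.ofMulAction ℚ Γ (Γ ⧸ Γ')).asAlgebraHom
        (x * (augIdem Γ' * trivIdem Γ')) (MonoidAlgebra.single ((1 : Γ) : Γ ⧸ Γ') 1) = w := by
      rw [← mul_assoc, ← (augIdem_spec Γ').central, mul_assoc, map_mul, map_mul,
        Module.End.mul_apply, Module.End.mul_apply, asAlgebraHom_trivIdem, hx,
        (augIdem_spec Γ').acts w hw]
    conv_lhs => rw [← h1]
    rw [← Module.End.mul_apply, ← map_mul, hone _ (I.mul_mem_left x h), h1]

omit [Finite Γ] in
theorem exists_smul_mem_groupRing (R : Subring ℚ) (x : MonoidAlgebra ℚ Γ) :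
    ∃ n : ℕ, n ≠ 0 ∧ n • x ∈ groupRing R Γ := by
  induction x using MonoidAlgebra.induction_linear with
  | zero => exact ⟨1, one_ne_zero, by simp⟩
  | add x y hx hy =>
    obtain ⟨n, hn, hx⟩ := hx
    obtain ⟨m, hm, hy⟩ := hy
    refine ⟨n * m, mul_ne_zero hn hm, ?_⟩
    rw [smul_add, mul_comm n m, mul_smul, mul_comm m n, mul_smul]
    exact Submodule.add_mem _ (Submodule.smul_of_tower_mem _ m hx)
      (Submodule.smul_of_tower_mem _ n hy)
  | single γ q =>
    refine ⟨q.den, q.den_ne_zero, ?_⟩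
    have : q.den • MonoidAlgebra.single γ q = q.num • MonoidAlgebra.of ℚ Γ γ := by
      rw [MonoidAlgebra.of_apply, MonoidAlgebra.smul_single, MonoidAlgebra.smul_single]
      congr 1
      rw [nsmul_eq_mul, zsmul_eq_mul, mul_one, Rat.den_mul_eq_num]
    rw [this]
    exact Submodule.smul_of_tower_mem _ _ (of_mem_groupRing R γ)

section

variable (Γ' : Subgroup Γ) {R : Subring ℚ} (O : Subalgebra R (MonoidAlgebra ℚ Γ))

theorem mem_leftInv_iff {x : MonoidAlgebra ℚ Γ} :
    x ∈ (leftInv Γ' O).toSubmodule ↔ x ∈ (eO Γ' O).toSubmodule ∧ trivIdem Γ' * x = x := by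
  refine and_congr_right fun _ => ⟨trivIdem_mul Γ', fun h τ hτ => ?_⟩
  rw [← h, ← mul_assoc, of_mul_trivIdem Γ' ⟨τ, hτ⟩]

theorem mem_heckeOrder_iff {x : MonoidAlgebra ℚ Γ} :
    x ∈ (heckeOrder Γ' O).toSubmodule ↔
      x ∈ (rightProj Γ' O).toSubmodule ∧ trivIdem Γ' * x = x := by
  refine and_congr_right fun _ => ⟨trivIdem_mul Γ', fun h τ hτ => ?_⟩
  rw [← h, ← mul_assoc, of_mul_trivIdem Γ' ⟨τ, hτ⟩]

theorem augIdem_mul_of_mem {x : MonoidAlgebra ℚ Γ} (hx : x ∈ (eO Γ' O).toSubmodule) :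
    augIdem Γ' * x = x :=
  (eO Γ' O).one_mul' hx

theorem mul_augIdem_of_mem {x : MonoidAlgebra ℚ Γ} (hx : x ∈ (eO Γ' O).toSubmodule) :
    x * augIdem Γ' = x :=
  (eO Γ' O).mul_one' hx

theorem rightProj_mul_leftInv_le :
    (rightProj Γ' O).toSubmodule * (leftInv Γ' O).toSubmodule ≤ (eO Γ' O).toSubmodule := by
  rw [Submodule.mul_le]
  rintro _ ⟨y, hy, rfl⟩ l hl
  rw [mem_leftInv_iff] at hl
  rw [mul_assoc, hl.2]
  exact (eO Γ' O).mul_mem' hy hl.1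

theorem leftInv_mul_rightProj_le :
    (leftInv Γ' O).toSubmodule * (rightProj Γ' O).toSubmodule ≤ (heckeOrder Γ' O).toSubmodule := by
  rw [Submodule.mul_le]
  rintro l hl _ ⟨y, hy, rfl⟩
  rw [mem_leftInv_iff] at hl
  rw [mem_heckeOrder_iff]
  refine ⟨⟨l * y, (eO Γ' O).mul_mem' hl.1 hy, (mul_assoc _ _ _).symm⟩, ?_⟩
  rw [← mul_assoc, hl.2]

theorem augIdem_mul_trivIdem_mem_rightProj :
    augIdem Γ' * trivIdem Γ' ∈ (rightProj Γ' O).toSubmodule :=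
  ⟨_, (eO Γ' O).one_mem', rfl⟩

theorem augIdem_comm_trivIdem : augIdem Γ' * trivIdem Γ' = trivIdem Γ' * augIdem Γ' :=
  (augIdem_spec Γ').central _

theorem augIdem_mul_trivIdem_idem :
    augIdem Γ' * trivIdem Γ' * (augIdem Γ' * trivIdem Γ') = augIdem Γ' * trivIdem Γ' := by
  conv_lhs => rw [mul_assoc, ← mul_assoc (trivIdem Γ'), ← augIdem_comm_trivIdem, mul_assoc,
    trivIdem_idem, ← mul_assoc, (augIdem_spec Γ').idem]

variable {O} (hΓ : groupRing R Γ ≤ Subalgebra.toSubmodule O)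
include hΓ

/-- The factor |Γ'| clears the denominator of e₁', which need not lie in O; this supplies the
multiples of the identity required by the criterion. -/
theorem card_smul_mem_leftInv :
    Nat.card Γ' • (augIdem Γ' * trivIdem Γ') ∈ (leftInv Γ' O).toSubmodule := by
  rw [mem_leftInv_iff]
  refine ⟨⟨_, hΓ (card_smul_trivIdem_mem R Γ'), (mul_smul_comm _ _ _).symm⟩, ?_⟩
  rw [mul_smul_comm, ← mul_assoc, ← augIdem_comm_trivIdem, mul_assoc, trivIdem_idem]

/-- The elements with a nonzero multiple in T form a two-sided ideal of ℚ[Γ], so the rational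
statement about e applies to it. -/
theorem exists_smul_augIdem_mem {T : Submodule R (MonoidAlgebra ℚ Γ)}
    (hT : T ≤ (eO Γ' O).toSubmodule)
    (hl : ∀ x ∈ (eO Γ' O).toSubmodule, ∀ y ∈ T, x * y ∈ T)
    (hr : ∀ y ∈ T, ∀ x ∈ (eO Γ' O).toSubmodule, y * x ∈ T)
    {m : ℕ} (hm : m ≠ 0) (h : m • (augIdem Γ' * trivIdem Γ') ∈ T) :
    ∃ n : ℕ, n ≠ 0 ∧ n • augIdem Γ' ∈ T := by
  let I : Ideal (MonoidAlgebra ℚ Γ) :=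
    { carrier := {x | ∃ n : ℕ, n ≠ 0 ∧ n • x ∈ T}
      zero_mem' := ⟨1, one_ne_zero, by simp⟩
      add_mem' := by
        rintro x y ⟨n, hn, hx⟩ ⟨m, hm, hy⟩
        refine ⟨n * m, mul_ne_zero hn hm, ?_⟩
        rw [smul_add, mul_comm n m, mul_smul, mul_comm m n, mul_smul]
        exact Submodule.add_mem _ (Submodule.smul_of_tower_mem _ m hx)
          (Submodule.smul_of_tower_mem _ n hy)
      smul_mem' := by
        rintro a x ⟨n, hn, hx⟩
        obtain ⟨k, hk, ha⟩ := exists_smul_mem_groupRing R a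
        refine ⟨k * n, mul_ne_zero hk hn, ?_⟩
        have h1 : (k * n) • (a * x) = augIdem Γ' * (k • a) * (n • x) := by
          rw [(augIdem_spec Γ').central, mul_assoc, augIdem_mul_of_mem Γ' O (hT hx),
            smul_mul_smul_comm]
        rw [smul_eq_mul, h1]
        exact hl _ ⟨_, hΓ ha, rfl⟩ _ hx }
  have hI : I.IsTwoSided := ⟨by
    rintro x a ⟨n, hn, hx⟩
    obtain ⟨k, hk, ha⟩ := exists_smul_mem_groupRing R a
    refine ⟨n * k, mul_ne_zero hn hk, ?_⟩
    have h1 : (n * k) • (x * a) = (n • x) * (augIdem Γ' * (k • a)) := by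
      rw [← mul_assoc, mul_augIdem_of_mem Γ' O (hT hx), smul_mul_smul_comm]
    rw [h1]
    exact hr _ hx _ ⟨_, hΓ ha, rfl⟩⟩
  exact augIdem_mem_of_isTwoSided Γ' I ⟨m, hm, h⟩

/-- The trace ideal of the projective module `e_{Γ/Γ'} O e₁'` is everything when `e_{Γ/Γ'} O` is
a maximal order. -/
theorem augIdem_mem_rightProj_mul_leftInv
    (hmax : IsMaximalOrder R (augIdem Γ') (eO Γ' O).toSubmodule) :
    augIdem Γ' ∈ (rightProj Γ' O).toSubmodule * (leftInv Γ' O).toSubmodule := by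
  have hl : ∀ x ∈ (eO Γ' O).toSubmodule,
      ∀ y ∈ (rightProj Γ' O).toSubmodule * (leftInv Γ' O).toSubmodule,
      x * y ∈ (rightProj Γ' O).toSubmodule * (leftInv Γ' O).toSubmodule := by
    intro x hx y hy
    induction hy using Submodule.mul_induction_on' with
    | mem_mul_mem p hp l hl =>
      rw [← mul_assoc]
      exact Submodule.mul_mem_mul ((rightProj Γ' O).left_mem' hx hp) hl
    | add y _ z _ hy hz => rw [mul_add]; exact Submodule.add_mem _ hy hz
  have hr : ∀ y ∈ (rightProj Γ' O).toSubmodule * (leftInv Γ' O).toSubmodule,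
      ∀ x ∈ (eO Γ' O).toSubmodule,
      y * x ∈ (rightProj Γ' O).toSubmodule * (leftInv Γ' O).toSubmodule := by
    intro y hy x hx
    induction hy using Submodule.mul_induction_on' with
    | mem_mul_mem p hp l hl =>
      rw [mul_assoc]
      exact Submodule.mul_mem_mul hp ((leftInv Γ' O).right_mem' hl hx)
    | add y _ z _ hy hz => rw [add_mul]; exact Submodule.add_mem _ hy hz
  have hε := augIdem_mul_trivIdem_mem_rightProj Γ' O
  obtain ⟨n, hn, hne⟩ := exists_smul_augIdem_mem Γ' hΓ (rightProj_mul_leftInv_le Γ' O) hl hr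
    (Nat.card_pos (α := Γ')).ne' (by
      have := Submodule.mul_mem_mul hε (card_smul_mem_leftInv Γ' hΓ)
      rwa [mul_smul_comm, augIdem_mul_trivIdem_idem] at this)
  refine hmax.one_mem_of_forall_mul_mem (rightProj_mul_leftInv_le Γ' O) hl hr hn hne
    fun a _ _ ha x hx => ?_
  -- Since ε ∈ P and εl = l, the element la = (εl)a lies in PLa ⊆ Λ, and it is still fixed by e₁'.
  -- Hence La ⊆ L, and so PLa ⊆ PL.
  have hla : ∀ l ∈ (leftInv Γ' O).toSubmodule, l * a ∈ (leftInv Γ' O).toSubmodule := by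
    intro l hl
    have h1 := ha _ (Submodule.mul_mem_mul hε hl)
    rw [mem_leftInv_iff] at hl
    rw [mul_assoc (augIdem Γ'), hl.2, augIdem_mul_of_mem Γ' O hl.1] at h1
    exact (mem_leftInv_iff Γ' O).2 ⟨h1, by rw [← mul_assoc, hl.2]⟩
  induction hx using Submodule.mul_induction_on' with
  | mem_mul_mem p hp l hl =>
    rw [mul_assoc]
    exact Submodule.mul_mem_mul hp (hla l hl)
  | add y _ z _ hy hz => rw [add_mul]; exact Submodule.add_mem _ hy hz

end

end HeckeModel

/-! ### Maximality of o and the second membership. -/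

namespace HeckeModel

variable {Γ : Type u} [Group Γ] [Finite Γ] (Γ' : Subgroup Γ)

section

variable {R : Subring ℚ} (O : Subalgebra R (MonoidAlgebra ℚ Γ))

theorem heckeOrder_le_rightProj : (heckeOrder Γ' O).toSubmodule ≤ (rightProj Γ' O).toSubmodule :=
  fun _ hx => hx.1

theorem augIdem_mul_of_mem_rightProj {x : MonoidAlgebra ℚ Γ}
    (hx : x ∈ (rightProj Γ' O).toSubmodule) : augIdem Γ' * x = x :=
  (rightProj Γ' O).one_left' hx

theorem mul_one_of_mem_rightProj {x : MonoidAlgebra ℚ Γ}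
    (hx : x ∈ (rightProj Γ' O).toSubmodule) : x * (augIdem Γ' * trivIdem Γ') = x :=
  (rightProj Γ' O).one_right' hx

theorem rightProj_eq_map :
    (rightProj Γ' O).toSubmodule =
      (eO Γ' O).toSubmodule.map (LinearMap.mulRight R (trivIdem Γ')) := by
  ext a
  exact ⟨fun ⟨x, hx, h⟩ => ⟨x, hx, h.symm⟩, fun ⟨x, hx, h⟩ => ⟨x, hx, h.symm⟩⟩

variable {O}

theorem rightProj_fg (hO : IsOrder R 1 (Subalgebra.toSubmodule O)) :
    (rightProj Γ' O).toSubmodule.FG := by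
  rw [rightProj_eq_map]
  exact (isOrder_eO Γ' hO).fg.map _

theorem isOrder_heckeOrder (hO : IsOrder R 1 (Subalgebra.toSubmodule O))
    (hΓ : groupRing R Γ ≤ Subalgebra.toSubmodule O) :
    IsOrder R (augIdem Γ' * trivIdem Γ') (heckeOrder Γ' O).toSubmodule where
  one_mem := (heckeOrder Γ' O).one_mem'
  mul_mem _ hx _ hy := (heckeOrder Γ' O).mul_mem' hx hy
  one_mul _ hx := (heckeOrder Γ' O).one_mul' hx
  mul_one _ hx := (heckeOrder Γ' O).mul_one' hx
  fg := submodule_fg_of_le (rightProj_fg Γ' hO) (heckeOrder_le_rightProj Γ' O)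
  span x := by
    have hcard : (Nat.card Γ' : ℚ) ≠ 0 := by exact_mod_cast Nat.card_pos.ne'
    have h1 := hO.span x
    rw [one_mul, mul_one] at h1
    induction h1 using Submodule.span_induction with
    | mem x hx =>
      have h2 : Nat.card Γ' • (augIdem Γ' * trivIdem Γ' * x * (augIdem Γ' * trivIdem Γ')) ∈
          (heckeOrder Γ' O).toSubmodule := by
        -- Factor |Γ'| εxε as (|Γ'| ε)(xε), an element of LP.
        refine leftInv_mul_rightProj_le Γ' O ?_
        have hx' : x * (augIdem Γ' * trivIdem Γ') ∈ (rightProj Γ' O).toSubmodule := by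
          rw [← mul_assoc, ← (augIdem_spec Γ').central]
          exact ⟨_, ⟨x, hx, rfl⟩, rfl⟩
        rw [mul_assoc, ← smul_mul_assoc]
        exact Submodule.mul_mem_mul (card_smul_mem_leftInv Γ' hΓ) hx'
      rw [← inv_smul_smul₀ hcard (_ * _), Nat.cast_smul_eq_nsmul]
      exact Submodule.smul_mem _ _ (Submodule.subset_span h2)
    | zero => rw [mul_zero, zero_mul]; exact Submodule.zero_mem _
    | add x y _ _ hx hy => rw [mul_add, add_mul]; exact Submodule.add_mem _ hx hy
    | smul r x _ hx =>
      rw [mul_smul_comm, smul_mul_assoc]; exact Submodule.smul_mem _ _ hx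

end

variable {S : Set Nat.Primes} {O : Subalgebra (zS S) (MonoidAlgebra ℚ Γ)}
  (hgood : ∀ p ∈ S, IsGoodPrime p (augIdem Γ'))
  (hO : IsOrder (zS S) 1 (Subalgebra.toSubmodule O))
  (hΓ : groupRing (zS S) Γ ≤ Subalgebra.toSubmodule O)
include hgood hO hΓ

/-- Reflexivity of `e_{Γ/Γ'} O e₁'`. -/
theorem mem_rightProj_of_mul_mem {x : MonoidAlgebra ℚ Γ}
    (hx : x * (augIdem Γ' * trivIdem Γ') = x)
    (h : ∀ l ∈ (leftInv Γ' O).toSubmodule, x * l ∈ (eO Γ' O).toSubmodule) :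
    x ∈ (rightProj Γ' O).toSubmodule := by
  -- Testing against l = |Γ'| ε shows that |Γ'| x has coefficients in ℤ_S, and the coset description
  -- then writes x as ze₁' with z ∈ ℤ_S[Γ].
  have h1 := h _ (card_smul_mem_leftInv Γ' hΓ)
  rw [mul_smul_comm, hx, mem_eO_iff_of_isGoodPrime Γ' hgood hO hΓ] at h1
  have hxe : x * trivIdem Γ' = x := by
    rw [← hx, mul_assoc, mul_assoc, trivIdem_idem]
  have hex : augIdem Γ' * x = x := by
    rw [(augIdem_spec Γ').central, ← hx, augIdem_comm_trivIdem, mul_assoc, mul_assoc,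
      (augIdem_spec Γ').idem]
  obtain ⟨z, hz, rfl⟩ := exists_eq_mul_trivIdem Γ' hxe h1.1
  exact ⟨augIdem Γ' * z, ⟨z, hΓ hz, rfl⟩, by rw [mul_assoc, hex]⟩

/-- An order o' ⊇ o gives D = Po'L, closed under multiplication because LP ⊆ o ⊆ o', and containing
Λ because e ∈ PL. Maximality of Λ gives D = Λ, and reflexivity of P recovers o' ⊆ o. -/
theorem isMaximalOrder_heckeOrder :
    IsMaximalOrder (zS S) (augIdem Γ' * trivIdem Γ') (heckeOrder Γ' O).toSubmodule := by
  have hmax := isMaximalOrder_eO Γ' hgood hO hΓ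
  have hone := augIdem_mem_rightProj_mul_leftInv Γ' hΓ hmax
  refine ⟨isOrder_heckeOrder Γ' hO hΓ, fun o' ho' hle => le_antisymm (fun a ha => ?_) hle⟩
  set P := (rightProj Γ' O).toSubmodule
  set L := (leftInv Γ' O).toSubmodule
  have hPD : P * L ≤ P * o' * L := by
    refine mul_le_mul' (fun p hp => ?_) le_rfl
    rw [← mul_one_of_mem_rightProj Γ' O hp]
    exact Submodule.mul_mem_mul hp ho'.one_mem
  have hΛP : (eO Γ' O).toSubmodule * P ≤ P :=
    Submodule.mul_le.2 fun x hx p hp => (rightProj Γ' O).left_mem' hx hp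
  have hΛD : (eO Γ' O).toSubmodule ≤ P * o' * L := fun y hy => by
    have h1 : (eO Γ' O).toSubmodule * (P * L) ≤ P * o' * L := by
      rw [← mul_assoc]
      exact (mul_le_mul' hΛP le_rfl).trans hPD
    rw [← mul_augIdem_of_mem Γ' O hy]
    exact h1 (Submodule.mul_mem_mul hy hone)
  have ho'o' : o' * o' ≤ o' := Submodule.mul_le.2 ho'.mul_mem
  have hD : IsOrder (zS S) (augIdem Γ') (P * o' * L) :=
    { one_mem := hPD hone
      mul_mem := fun x hx y hy => by
        have h1 : P * o' * L * (P * o' * L) ≤ P * o' * L := calc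
          P * o' * L * (P * o' * L) = P * (o' * ((L * P) * o')) * L := by simp only [mul_assoc]
          _ ≤ P * (o' * (o' * o')) * L := by
            gcongr
            exact (leftInv_mul_rightProj_le Γ' O).trans hle
          _ ≤ P * (o' * o') * L := by gcongr
          _ ≤ P * o' * L := by gcongr
        exact h1 (Submodule.mul_mem_mul hx hy)
      one_mul := fun x hx => by
        rw [mul_assoc] at hx
        induction hx using Submodule.mul_induction_on' with
        | mem_mul_mem p hp l hl => rw [← mul_assoc, augIdem_mul_of_mem_rightProj Γ' O hp]
        | add y _ z _ hy hz => rw [mul_add, hy, hz]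
      mul_one := fun x hx => by
        induction hx using Submodule.mul_induction_on' with
        | mem_mul_mem p hp l hl => rw [mul_assoc, mul_augIdem_of_mem Γ' O hl.1]
        | add y _ z _ hy hz => rw [add_mul, hy, hz]
      fg := ((rightProj_fg Γ' hO).mul ho'.fg).mul
        (submodule_fg_of_le hmax.1.fg fun x hx => hx.1)
      span := fun x => Submodule.span_mono hΛD (hmax.1.span x) }
  have hDΛ := hmax.2 _ hD hΛD
  rw [mem_heckeOrder_iff]
  constructor
  · refine mem_rightProj_of_mul_mem Γ' hgood hO hΓ (ho'.mul_one a ha) fun l hl => ?_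
    -- al = εal with ε ∈ P, so al ∈ Po'L = Λ.
    rw [← hDΛ, ← ho'.one_mul a ha]
    exact Submodule.mul_mem_mul
      (Submodule.mul_mem_mul (augIdem_mul_trivIdem_mem_rightProj Γ' O) ha) hl
  · rw [← ho'.one_mul a ha, augIdem_comm_trivIdem, ← mul_assoc, ← mul_assoc, trivIdem_idem]

/-- The criterion is applied to the ideal LP of the maximal order o. Its last condition holds
because LPa ⊆ o already forces a ∈ o. -/
theorem augIdem_mul_trivIdem_mem_leftInv_mul_rightProj :
    augIdem Γ' * trivIdem Γ' ∈ (leftInv Γ' O).toSubmodule * (rightProj Γ' O).toSubmodule := by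
  have hmax := isMaximalOrder_eO Γ' hgood hO hΓ
  have hone := augIdem_mem_rightProj_mul_leftInv Γ' hΓ hmax
  have hε := augIdem_mul_trivIdem_mem_rightProj Γ' O
  have hr : ∀ y ∈ (leftInv Γ' O).toSubmodule * (rightProj Γ' O).toSubmodule,
      ∀ x ∈ (heckeOrder Γ' O).toSubmodule,
      y * x ∈ (leftInv Γ' O).toSubmodule * (rightProj Γ' O).toSubmodule := by
    intro y hy x hx
    induction hy using Submodule.mul_induction_on' with
    | mem_mul_mem l hl p hp =>
      rw [mul_assoc]
      exact Submodule.mul_mem_mul hl ((rightProj Γ' O).right_mem' hp hx)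
    | add y _ z _ hy hz => rw [add_mul]; exact Submodule.add_mem _ hy hz
  refine (isMaximalOrder_heckeOrder Γ' hgood hO hΓ).one_mem_of_forall_mul_mem
    (leftInv_mul_rightProj_le Γ' O) (fun x hx y hy => ?_) hr
    (Nat.card_pos (α := Γ')).ne' ?_ fun a ha _ hUa x hx => hr x hx a ?_
  · induction hy using Submodule.mul_induction_on' with
    | mem_mul_mem l hl p hp =>
      rw [← mul_assoc]
      exact Submodule.mul_mem_mul ((leftInv Γ' O).left_mem' hx hl) hp
    | add y _ z _ hy hz => rw [mul_add]; exact Submodule.add_mem _ hy hz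
  · have := Submodule.mul_mem_mul (card_smul_mem_leftInv Γ' hΓ) hε
    rwa [smul_mul_assoc, augIdem_mul_trivIdem_idem] at this
  -- For p ∈ P and l ∈ L, la = (lε)a ∈ LPa ⊆ o, so pla ∈ Po ⊆ P. Since e ∈ PL, taking t = e gives a
  -- = ea ∈ P.
  · have h1 : ∀ t ∈ (rightProj Γ' O).toSubmodule * (leftInv Γ' O).toSubmodule,
        t * a ∈ (rightProj Γ' O).toSubmodule := by
      intro t ht
      induction ht using Submodule.mul_induction_on' with
      | mem_mul_mem p hp l hl =>
        have h2 := (rightProj Γ' O).right_mem' hp (hUa _ (Submodule.mul_mem_mul hl hε))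
        rw [mul_assoc l, ha, ← mul_assoc] at h2
        exact h2
      | add y _ z _ hy hz => rw [add_mul]; exact Submodule.add_mem _ hy hz
    rw [mem_heckeOrder_iff]
    constructor
    · have h2 := h1 _ hone
      rwa [← ha, ← mul_assoc, ← mul_assoc, (augIdem_spec Γ').idem, ha] at h2
    · rw [← ha, augIdem_comm_trivIdem, ← mul_assoc, ← mul_assoc, trivIdem_idem]

end HeckeModel

/-! ### Maps out of the balanced tensor product. -/

namespace HeckeModel

section Lift

variable {T R M N : Type*} [Ring T] [Ring R] [AddCommGroup M] [Module T M] [Module Rᵐᵒᵖ M]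
  [AddCommGroup N] [Module R N]

theorem BTensor.induction {motive : BTensor T R M N → Prop} (x : BTensor T R M N)
    (zero : motive 0) (tmul : ∀ m n, motive (btmul T R m n))
    (add : ∀ x y, motive x → motive y → motive (x + y)) : motive x := by
  obtain ⟨x, rfl⟩ := Submodule.mkQ_surjective _ x
  induction x using TensorProduct.induction_on with
  | zero => rwa [map_zero]
  | tmul m n => exact tmul m n
  | add x y hx hy => rw [map_add]; exact add _ _ hx hy

theorem smul_btmul (t : T) (m : M) (n : N) :
    t • btmul T R m n = btmul T R (t • m) n := by
  rw [btmul, ← map_smul, TensorProduct.smul_tmul']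
  rfl

theorem op_smul_btmul (r : R) (m : M) (n : N) :
    btmul T R (MulOpposite.op r • m) n = btmul T R m (r • n) :=
  (Submodule.Quotient.eq _).2 (Submodule.subset_span ⟨m, r, n, rfl⟩)

theorem btmul_add (m : M) (n n' : N) :
    btmul T R m (n + n') = btmul T R m n + btmul T R m n' := by
  rw [btmul, TensorProduct.tmul_add, map_add]
  rfl

theorem btmul_zero (m : M) : btmul T R m (0 : N) = 0 := by
  rw [btmul, TensorProduct.tmul_zero, map_zero]

theorem btensorMap_btmul {N' : Type*} [AddCommGroup N'] [Module R N'] (f : N →ₗ[R] N') (m : M)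
    (n : N) : btensorMap T R M f (btmul T R m n) = btmul T R m (f n) := rfl

variable [SMulCommClass T Rᵐᵒᵖ M]

/-- The additive map on `M ⊗_R N` induced by a balanced biadditive map. -/
def BTensor.lift {K : Type*} [AddCommGroup K] (f : M →+ N →+ K)
    (hf : ∀ (r : R) m n, f (MulOpposite.op r • m) n = f m (r • n)) : BTensor T R M N →+ K :=
  QuotientAddGroup.lift (tensorRel T R M N).toAddSubgroup
    (TensorProduct.liftAddHom f fun z m n => by simp) (by
      -- The relations are a T-span while f is only additive, so vanishing is proved on all
      -- T-multiples at once and then specialized to t = 1.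
      have h : ∀ x ∈ tensorRel T R M N, ∀ t : T,
          TensorProduct.liftAddHom f (fun z m n => by simp) (t • x) = 0 := by
        intro x hx
        induction hx using Submodule.span_induction with
        | mem x hx =>
          obtain ⟨m, r, n, rfl⟩ := hx
          intro t
          rw [smul_sub, TensorProduct.smul_tmul', TensorProduct.smul_tmul', map_sub,
            TensorProduct.liftAddHom_tmul, TensorProduct.liftAddHom_tmul, smul_comm, hf, sub_self]
        | zero => intro t; rw [smul_zero, map_zero]
        | add x y _ _ hx hy => intro t; rw [smul_add, map_add, hx, hy, add_zero]
        | smul s x _ hx => intro t; rw [smul_smul]; exact hx _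
      intro x hx
      simpa using h x hx 1)

end Lift

/-! ### Morita equivalence from a pair of bimodules in an ambient ring. -/

section Morita

variable {R : Type*} {A : Type u} [CommRing R] [Ring A] [Algebra R A] {B C : SubRingWithOne R A}
  (P : SubBimodule B C) (Q : SubBimodule C B)

/-- An element of `B`, as a term of the underlying type. -/
def SubRingWithOne.elt (B : SubRingWithOne R A) (t : A) (ht : t ∈ B.toSubmodule) : B.Elt := ⟨t, ht⟩

/-- An element of `P`, as a term of the underlying type. -/
def SubBimodule.elt (P : SubBimodule B C) (t : A) (ht : t ∈ P.toSubmodule) : P.Elt := ⟨t, ht⟩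

/-- The product of `p ∈ P` and `q ∈ Q`, as an element of `B`. -/
def SubBimodule.mul (hPQ : P.toSubmodule * Q.toSubmodule ≤ B.toSubmodule) (p : P.Elt) (q : Q.Elt) :
    B.Elt :=
  ⟨p.1 * q.1, hPQ (Submodule.mul_mem_mul p.2 q.2)⟩

variable {N : Type*} [AddCommGroup N] [Module B.Elt N]

/-- The map `P ⊗_C (Q ⊗_B N) → N` given by `p ⊗ (q ⊗ n) ↦ (p q) n`. -/
def SubBimodule.eval (hPQ : P.toSubmodule * Q.toSubmodule ≤ B.toSubmodule) :
    BTensor B.Elt C.Elt P.Elt (BTensor C.Elt B.Elt Q.Elt N) →ₗ[B.Elt] N :=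
  let g (p : P.Elt) : BTensor C.Elt B.Elt Q.Elt N →+ N := BTensor.lift
    (AddMonoidHom.mk' (fun q => DistribSMul.toAddMonoidHom N (P.mul Q hPQ p q)) fun q q' => by
      ext n
      change P.mul Q hPQ p (q + q') • n = P.mul Q hPQ p q • n + P.mul Q hPQ p q' • n
      rw [← add_smul]
      congr 1
      exact Subtype.ext (mul_add _ _ _))
    (fun b q n => by
      change P.mul Q hPQ p (MulOpposite.op b • q) • n = P.mul Q hPQ p q • b • n
      rw [smul_smul]
      congr 1
      exact Subtype.ext (mul_assoc _ _ _).symm)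
  let ev : BTensor B.Elt C.Elt P.Elt (BTensor C.Elt B.Elt Q.Elt N) →+ N := BTensor.lift
    (AddMonoidHom.mk' g fun p p' => by
      ext x
      induction x using BTensor.induction with
      | zero => simp
      | tmul q n =>
        change P.mul Q hPQ (p + p') q • n = P.mul Q hPQ p q • n + P.mul Q hPQ p' q • n
        rw [← add_smul]
        congr 1
        exact Subtype.ext (add_mul _ _ _)
      | add x y hx hy => rw [map_add, map_add, hx, hy])
    (fun c p x => by
      induction x using BTensor.induction with
      | zero => simp
      | tmul q n =>
        rw [smul_btmul]
        change P.mul Q hPQ (MulOpposite.op c • p) q • n = P.mul Q hPQ p (c • q) • n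
        congr 1
        exact Subtype.ext (mul_assoc _ _ _)
      | add x y hx hy => rw [map_add, smul_add, map_add, hx, hy])
  { ev with
    map_smul' := fun b x => by
      change ev (b • x) = b • ev x
      induction x using BTensor.induction with
      | zero => simp
      | tmul p x =>
        rw [smul_btmul]
        change g (b • p) x = b • g p x
        induction x using BTensor.induction with
        | zero => simp
        | tmul q n =>
          change P.mul Q hPQ (b • p) q • n = b • P.mul Q hPQ p q • n
          rw [smul_smul]
          congr 1
          exact Subtype.ext (mul_assoc _ _ _)
        | add x y hx hy => rw [map_add, map_add, hx, hy, smul_add]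
      | add x y hx hy => rw [smul_add, map_add, map_add, hx, hy, smul_add] }

theorem SubBimodule.eval_btmul (hPQ : P.toSubmodule * Q.toSubmodule ≤ B.toSubmodule) (p : P.Elt)
    (q : Q.Elt) (n : N) :
    P.eval Q hPQ (btmul B.Elt C.Elt p (btmul C.Elt B.Elt q n)) = P.mul Q hPQ p q • n := rfl

/-- On pure tensors, (pq)p' = p(qp') moves qp' ∈ C across the outer tensor sign, and (qp')q' =
q(p'q') moves p'q' ∈ B across the inner one. -/
theorem SubBimodule.mul_smul_eq (hPQ : P.toSubmodule * Q.toSubmodule ≤ B.toSubmodule)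
    (hQP : Q.toSubmodule * P.toSubmodule ≤ C.toSubmodule) (p : P.Elt) (q : Q.Elt)
    (x : BTensor B.Elt C.Elt P.Elt (BTensor C.Elt B.Elt Q.Elt N)) :
    P.mul Q hPQ p q • x = btmul B.Elt C.Elt p (btmul C.Elt B.Elt q (P.eval Q hPQ x)) := by
  induction x using BTensor.induction with
  | zero => rw [smul_zero, map_zero, btmul_zero, btmul_zero]
  | tmul p' x =>
    induction x using BTensor.induction with
    | zero => rw [btmul_zero, smul_zero, map_zero, btmul_zero, btmul_zero]
    | tmul q' n =>
      have h1 : P.mul Q hPQ p q • p' = MulOpposite.op (Q.mul P hQP q p') • p :=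
        Subtype.ext (mul_assoc _ _ _)
      have h2 : Q.mul P hQP q p' • q' = MulOpposite.op (P.mul Q hPQ p' q') • q :=
        Subtype.ext (mul_assoc _ _ _)
      rw [P.eval_btmul, smul_btmul, h1, op_smul_btmul, smul_btmul, h2, op_smul_btmul]
    | add x y hx hy => rw [btmul_add, smul_add, map_add, btmul_add, btmul_add, hx, hy]
  | add x y hx hy => rw [smul_add, map_add, btmul_add, btmul_add, hx, hy]

/-- Writing 1 as a sum of products pq does both halves: (pq)x = p ⊗ (q ⊗ eval x) kills the kernel,
and (pq)n = eval(p ⊗ (q ⊗ n)) gives surjectivity. -/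
theorem SubBimodule.eval_bijective (hPQ : P.toSubmodule * Q.toSubmodule ≤ B.toSubmodule)
    (hQP : Q.toSubmodule * P.toSubmodule ≤ C.toSubmodule)
    (hone : B.one' ∈ P.toSubmodule * Q.toSubmodule) :
    Function.Bijective (P.eval Q hPQ (N := N)) := by
  constructor
  · rw [injective_iff_map_eq_zero]
    intro x hx
    have h : ∀ t (ht : t ∈ P.toSubmodule * Q.toSubmodule), B.elt t (hPQ ht) • x = 0 := by
      intro t ht
      induction ht using Submodule.mul_induction_on' with
      | mem_mul_mem p hp q hq =>
        have := P.mul_smul_eq Q hPQ hQP (P.elt p hp) (Q.elt q hq) x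
        rw [hx, btmul_zero, btmul_zero] at this
        exact this
      | add s hs t ht hs' ht' =>
        have : B.elt (s + t) (hPQ (Submodule.add_mem _ hs ht)) =
            B.elt s (hPQ hs) + B.elt t (hPQ ht) := rfl
        rw [this, add_smul, hs', ht', add_zero]
    exact (one_smul B.Elt x).symm.trans (h _ hone)
  · intro n
    have h : ∀ t (ht : t ∈ P.toSubmodule * Q.toSubmodule),
        B.elt t (hPQ ht) • n ∈ LinearMap.range (P.eval Q hPQ (N := N)) := by
      intro t ht
      induction ht using Submodule.mul_induction_on' with
      | mem_mul_mem p hp q hq => exact ⟨_, P.eval_btmul Q hPQ (P.elt p hp) (Q.elt q hq) n⟩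
      | add s hs t ht hs' ht' =>
        have : B.elt (s + t) (hPQ (Submodule.add_mem _ hs ht)) =
            B.elt s (hPQ hs) + B.elt t (hPQ ht) := rfl
        rw [this, add_smul]
        exact Submodule.add_mem _ hs' ht'
    have h1 := h _ hone
    rwa [show B.elt B.one' (hPQ hone) = 1 from rfl, one_smul] at h1

theorem SubBimodule.eval_btensorMap (hPQ : P.toSubmodule * Q.toSubmodule ≤ B.toSubmodule)
    {N' : Type*} [AddCommGroup N'] [Module B.Elt N'] (f : N →ₗ[B.Elt] N')
    (x : BTensor B.Elt C.Elt P.Elt (BTensor C.Elt B.Elt Q.Elt N)) :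
    P.eval Q hPQ (btensorMap _ _ _ (btensorMap _ _ _ f) x) = f (P.eval Q hPQ x) := by
  induction x using BTensor.induction with
  | zero => rw [map_zero, map_zero, map_zero, map_zero]
  | tmul p x =>
    induction x using BTensor.induction with
    | zero => rw [btmul_zero, map_zero, map_zero, map_zero, map_zero]
    | tmul q n =>
      rw [btensorMap_btmul, btensorMap_btmul, P.eval_btmul, P.eval_btmul, map_smul]
    | add x y hx hy => rw [btmul_add, map_add, map_add, map_add, map_add, hx, hy]
  | add x y hx hy => rw [map_add, map_add, map_add, map_add, hx, hy]

/-- The natural isomorphism `P ⊗_C (Q ⊗_B -) ≅ 𝟭`. -/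
def SubBimodule.tensorCompIso (hPQ : P.toSubmodule * Q.toSubmodule ≤ B.toSubmodule)
    (hQP : Q.toSubmodule * P.toSubmodule ≤ C.toSubmodule)
    (hone : B.one' ∈ P.toSubmodule * Q.toSubmodule) :
    tensorFunctor.{u, v} C.Elt B.Elt Q.Elt ⋙ tensorFunctor.{u, v} B.Elt C.Elt P.Elt ≅
      𝟭 (ModuleCat.{max u v} B.Elt) :=
  NatIso.ofComponents
    (fun N => (LinearEquiv.ofBijective (P.eval Q hPQ (N := N))
      (P.eval_bijective Q hPQ hQP hone)).toModuleIso)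
    (fun f => ModuleCat.hom_ext (LinearMap.ext fun x => P.eval_btensorMap Q hPQ f.hom x))

/-- The equivalence of categories given by a pair of bimodules `P`, `Q` with `P Q = B` and
`Q P = C`. -/
def SubBimodule.equivalence (hPQ : P.toSubmodule * Q.toSubmodule ≤ B.toSubmodule)
    (hQP : Q.toSubmodule * P.toSubmodule ≤ C.toSubmodule)
    (hB : B.one' ∈ P.toSubmodule * Q.toSubmodule) (hC : C.one' ∈ Q.toSubmodule * P.toSubmodule) :
    ModuleCat.{max u v} B.Elt ≌ ModuleCat.{max u v} C.Elt :=
  CategoryTheory.Equivalence.mk (tensorFunctor.{u, v} C.Elt B.Elt Q.Elt)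
    (tensorFunctor.{u, v} B.Elt C.Elt P.Elt) (P.tensorCompIso Q hPQ hQP hB).symm
    (Q.tensorCompIso P hQP hPQ hC)

open scoped ModuleCat.Algebra in
-- Scalars of R act on Q in the same way from both sides, as q(r·1_B) = rq = (r·1_C)q.
theorem SubBimodule.tensorFunctor_linear :
    (tensorFunctor.{u, v} C.Elt B.Elt Q.Elt).Linear R where
  map_smul {N N'} f r := by
    refine ModuleCat.hom_ext (LinearMap.ext fun x => ?_)
    change btensorMap _ _ _ (r • f).hom x = algebraMap R C.Elt r • btensorMap _ _ _ f.hom x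
    induction x using BTensor.induction with
    | zero => simp
    | tmul q n =>
      rw [btensorMap_btmul, btensorMap_btmul, smul_btmul]
      change btmul _ _ q (algebraMap R B.Elt r • f.hom n) = _
      rw [← op_smul_btmul]
      congr 1
      refine Subtype.ext ?_
      change q.1 * (r • B.one') = (r • C.one') * q.1
      rw [mul_smul_comm, smul_mul_assoc, Q.one_left' q.2, Q.one_right' q.2]
    | add x y hx hy => rw [map_add, map_add, smul_add, hx, hy]

theorem SubBimodule.isMoritaEquivalent (hPQ : P.toSubmodule * Q.toSubmodule ≤ B.toSubmodule)
    (hQP : Q.toSubmodule * P.toSubmodule ≤ C.toSubmodule)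
    (hB : B.one' ∈ P.toSubmodule * Q.toSubmodule) (hC : C.one' ∈ Q.toSubmodule * P.toSubmodule) :
    IsMoritaEquivalent R B.Elt C.Elt :=
  ⟨⟨⟨P.equivalence.{u, u} Q hPQ hQP hB hC, Q.tensorFunctor_linear⟩⟩⟩

end Morita

end HeckeModel

/-! ### The action of o on Γ'-invariants. -/

namespace HeckeModel

/-- The inclusion of `B` in `A`. -/
def SubRingWithOne.subtype {R A : Type*} [CommRing R] [Ring A] [Algebra R A]
    (B : SubRingWithOne R A) : B.Elt →ₗ[R] A where
  toFun x := x.1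
  map_add' _ _ := rfl
  map_smul' _ _ := rfl

section Invariants

variable {Γ : Type u} [Group Γ] [Finite Γ] (Γ' : Subgroup Γ)

section

variable {R : Subring ℚ} {O : Subalgebra R (MonoidAlgebra ℚ Γ)}
  (hΓ : groupRing R Γ ≤ Subalgebra.toSubmodule O)

theorem groupElt_mul (γ δ : Γ) :
    groupElt Γ' hΓ (γ * δ) = groupElt Γ' hΓ γ * groupElt Γ' hΓ δ := by
  refine Subtype.ext ?_
  change augIdem Γ' * MonoidAlgebra.of ℚ Γ (γ * δ) =
    augIdem Γ' * MonoidAlgebra.of ℚ Γ γ * (augIdem Γ' * MonoidAlgebra.of ℚ Γ δ)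
  rw [← mul_assoc, ← (augIdem_spec Γ').central, ← mul_assoc, (augIdem_spec Γ').idem, map_mul,
    mul_assoc]

/-- The coefficients of an element of the group ring, as scalars of `e_{Γ/Γ'} O`. -/
theorem eq_sum_smul_groupElt [Fintype Γ] {σ : (eO Γ' O).Elt} (c : Γ → R)
    (hc : ∀ γ, (c γ : ℚ) = (show MonoidAlgebra ℚ Γ from σ.1).coeff γ) :
    σ = ∑ γ, (c γ • 1) * groupElt Γ' hΓ γ := by
  refine Subtype.ext ?_
  change σ.1 = (eO Γ' O).subtype (∑ γ, (c γ • 1) * groupElt Γ' hΓ γ)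
  rw [map_sum]
  have h : ∀ γ, (eO Γ' O).subtype ((c γ • 1) * groupElt Γ' hΓ γ) =
      augIdem Γ' * ((show MonoidAlgebra ℚ Γ from σ.1).coeff γ • MonoidAlgebra.of ℚ Γ γ) := by
    intro γ
    rw [smul_mul_assoc, one_mul, map_smul, mul_smul_comm, ← hc]
    rfl
  rw [Finset.sum_congr rfl fun γ _ => h γ, ← Finset.mul_sum, sum_coeff_smul_of]
  exact (augIdem_mul_of_mem Γ' O σ.2).symm

theorem groupElt_mul_coe_of_mem {x : (eO Γ' O).Elt} {τ : Γ}
    (hx : MonoidAlgebra.of ℚ Γ τ * x.1 = x.1) : groupElt Γ' hΓ τ * x = x := by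
  refine Subtype.ext ?_
  change augIdem Γ' * MonoidAlgebra.of ℚ Γ τ * x.1 = x.1
  rw [mul_assoc, hx, augIdem_mul_of_mem Γ' O x.2]

theorem exists_eq_mul_trivIdem_of_heckeOrder (a : (heckeOrder Γ' O).Elt) :
    ∃ σ : (eO Γ' O).Elt, a.1 = σ.1 * trivIdem Γ' := by
  obtain ⟨x, hx, h⟩ := a.2.1
  exact ⟨⟨x, hx⟩, h⟩

end

variable {S : Set Nat.Primes} {O : Subalgebra (zS S) (MonoidAlgebra ℚ Γ)}
  (hgood : ∀ p ∈ S, IsGoodPrime p (augIdem Γ'))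
  (hO : IsOrder (zS S) 1 (Subalgebra.toSubmodule O))
  (hΓ : groupRing (zS S) Γ ≤ Subalgebra.toSubmodule O)
  {G : Type v} [AddCommGroup G] [Module (eO Γ' O).Elt G]
include hgood hO

/-- Group σ by cosets of Γ': on an invariant g, each coset acts through the sum of its coefficients,
which vanishes. Dividing by |Γ'| in G is not allowed, so it matters that the coefficients lie in ℤ_S
and act on G. -/
theorem smul_eq_zero_of_mul_trivIdem_eq_zero {σ : (eO Γ' O).Elt} (hσ : σ.1 * trivIdem Γ' = 0)
    {g : G} (hg : g ∈ invariants Γ' hΓ G) : σ • g = 0 := by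
  classical
  have := Fintype.ofFinite Γ
  have hmem := mem_groupRing_iff.1 ((mem_eO_iff_of_isGoodPrime Γ' hgood hO hΓ).1 σ.2).1
  let c : Γ → zS S := fun γ => ⟨_, hmem γ⟩
  rw [eq_sum_smul_groupElt Γ' hΓ (σ := σ) c fun γ => rfl, sum_eq_sum_quotient_sum Γ',
    Finset.sum_smul]
  refine Finset.sum_eq_zero fun q _ => ?_
  have h : ∀ τ : Γ', ((c (q.out * τ) • (1 : (eO Γ' O).Elt)) * groupElt Γ' hΓ (q.out * τ)) • g =
      (c (q.out * τ) • (1 : (eO Γ' O).Elt)) • groupElt Γ' hΓ q.out • g := by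
    intro τ
    rw [groupElt_mul, mul_smul, mul_smul, hg τ τ.2]
  have h0 : ∑ τ : Γ', c (q.out * τ) = 0 := by
    refine Subtype.ext ?_
    rw [AddSubmonoidClass.coe_finsetSum]
    exact sum_coeff_mul_eq_zero Γ' hσ q.out
  rw [Finset.sum_smul, Finset.sum_congr rfl fun τ _ => h τ, ← Finset.sum_smul, ← Finset.sum_smul,
    h0, zero_smul, zero_smul]

theorem smul_eq_smul_of_mul_trivIdem_eq {σ σ' : (eO Γ' O).Elt}
    (h : σ.1 * trivIdem Γ' = σ'.1 * trivIdem Γ') {g : G} (hg : g ∈ invariants Γ' hΓ G) :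
    σ • g = σ' • g := by
  rw [← sub_eq_zero, ← sub_smul]
  refine smul_eq_zero_of_mul_trivIdem_eq_zero Γ' hgood hO hΓ ?_ hg
  change (σ.1 - σ'.1) * trivIdem Γ' = 0
  rw [sub_mul, h, sub_self]

theorem smul_mem_invariants {a : (heckeOrder Γ' O).Elt} {σ : (eO Γ' O).Elt}
    (h : a.1 = σ.1 * trivIdem Γ') {g : G} (hg : g ∈ invariants Γ' hΓ G) :
    σ • g ∈ invariants Γ' hΓ G := by
  intro τ hτ
  rw [smul_smul]
  refine smul_eq_smul_of_mul_trivIdem_eq Γ' hgood hO hΓ ?_ hg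
  change augIdem Γ' * MonoidAlgebra.of ℚ Γ τ * σ.1 * trivIdem Γ' = σ.1 * trivIdem Γ'
  rw [mul_assoc, ← h, mul_assoc, a.2.2 τ hτ]
  exact augIdem_mul_of_mem_rightProj Γ' O a.2.1

/-- The action `(σ e₁') g = σ g` of `o` on the `Γ'`-invariants of an `e_{Γ/Γ'} O`-module. -/
@[reducible] def invariantsModule (G : Type v) [AddCommGroup G] [Module (eO Γ' O).Elt G] :
    Module (heckeOrder Γ' O).Elt (invariants Γ' hΓ G) where
  -- The representative σ is chosen arbitrarily; by the preceding lemmas the result depends only on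
  -- σe₁'.
  smul a g := ⟨(exists_eq_mul_trivIdem_of_heckeOrder Γ' a).choose • g.1,
    smul_mem_invariants Γ' hgood hO hΓ (exists_eq_mul_trivIdem_of_heckeOrder Γ' a).choose_spec g.2⟩
  one_smul g := Subtype.ext <|
    (smul_eq_smul_of_mul_trivIdem_eq Γ' hgood hO hΓ (σ' := 1)
      (exists_eq_mul_trivIdem_of_heckeOrder Γ' 1).choose_spec.symm g.2).trans (one_smul _ _)
  mul_smul a b g := Subtype.ext <| by
    have ha := (exists_eq_mul_trivIdem_of_heckeOrder Γ' a).choose_spec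
    have hb := (exists_eq_mul_trivIdem_of_heckeOrder Γ' b).choose_spec
    refine (smul_eq_smul_of_mul_trivIdem_eq Γ' hgood hO hΓ ?_ g.2).trans (mul_smul
      (exists_eq_mul_trivIdem_of_heckeOrder Γ' a).choose
      (exists_eq_mul_trivIdem_of_heckeOrder Γ' b).choose g.1)
    refine (exists_eq_mul_trivIdem_of_heckeOrder Γ' (a * b)).choose_spec.symm.trans ?_
    change a.1 * b.1 = _ * _ * _
    rw [mul_assoc, ← hb]
    -- With a = σe₁', invariance of b gives ab = σ(e₁'b) = σb, so the product of the representatives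
    -- represents ab.
    conv_lhs => rw [ha, mul_assoc, ((mem_heckeOrder_iff Γ' O).1 b.2).2]
  smul_zero a := Subtype.ext (smul_zero _)
  smul_add a g h := Subtype.ext (smul_add _ _ _)
  add_smul a b g := Subtype.ext <| by
    have ha := (exists_eq_mul_trivIdem_of_heckeOrder Γ' a).choose_spec
    have hb := (exists_eq_mul_trivIdem_of_heckeOrder Γ' b).choose_spec
    refine (smul_eq_smul_of_mul_trivIdem_eq Γ' hgood hO hΓ ?_ g.2).trans (add_smul
      (exists_eq_mul_trivIdem_of_heckeOrder Γ' a).choose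
      (exists_eq_mul_trivIdem_of_heckeOrder Γ' b).choose g.1)
    refine (exists_eq_mul_trivIdem_of_heckeOrder Γ' (a + b)).choose_spec.symm.trans ?_
    change a.1 + b.1 = (_ + _) * _
    rw [add_mul, ← ha, ← hb]
  zero_smul g := Subtype.ext <|
    (smul_eq_smul_of_mul_trivIdem_eq Γ' hgood hO hΓ (σ' := 0)
      ((exists_eq_mul_trivIdem_of_heckeOrder Γ' 0).choose_spec.symm.trans
        (zero_mul _).symm) g.2).trans (zero_smul _ _)

theorem coe_invariantsModule_smul {a : (heckeOrder Γ' O).Elt} {σ : (eO Γ' O).Elt}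
    (h : a.1 = σ.1 * trivIdem Γ') (g : invariants Γ' hΓ G) :
    letI := invariantsModule Γ' hgood hO hΓ G
    ((a • g : invariants Γ' hΓ G) : G) = σ • (g : G) :=
  smul_eq_smul_of_mul_trivIdem_eq Γ' hgood hO hΓ
    ((exists_eq_mul_trivIdem_of_heckeOrder Γ' a).choose_spec.symm.trans h) g.2

omit hgood hO in
theorem incl_smul_mem_invariants (x : (leftInv Γ' O).Elt) (g : G) :
    leftInv.incl Γ' O x • g ∈ invariants Γ' hΓ G := fun τ hτ => by
  rw [smul_smul, groupElt_mul_coe_of_mem Γ' hΓ (x := leftInv.incl Γ' O x) (x.2.2 τ hτ)]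

/-- The map `^{Γ'}(e_{Γ/Γ'} O) ⊗ G → ^{Γ'}G` given by `x ⊗ g ↦ x g`. -/
def tensorToInvariants (G : Type v) [AddCommGroup G] [Module (eO Γ' O).Elt G] :
    letI := invariantsModule Γ' hgood hO hΓ G
    BTensor (heckeOrder Γ' O).Elt (eO Γ' O).Elt (leftInv Γ' O).Elt G
      →ₗ[(heckeOrder Γ' O).Elt] invariants Γ' hΓ G :=
  letI := invariantsModule Γ' hgood hO hΓ G
  let ψ : BTensor (heckeOrder Γ' O).Elt (eO Γ' O).Elt (leftInv Γ' O).Elt G →+ invariants Γ' hΓ G :=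
    BTensor.lift
      (AddMonoidHom.mk' (fun x => AddMonoidHom.mk'
          (fun g => ⟨leftInv.incl Γ' O x • g, incl_smul_mem_invariants Γ' hΓ x g⟩)
          fun g h => Subtype.ext (smul_add _ _ _))
        fun x y => by
          ext g
          exact add_smul (leftInv.incl Γ' O x) (leftInv.incl Γ' O y) g)
      (fun b x g => Subtype.ext (mul_smul (leftInv.incl Γ' O x) b g))
  { ψ with
    map_smul' := fun a t => by
      change ψ (a • t) = a • ψ t
      induction t using BTensor.induction with
      | zero => simp
      | tmul x g =>
        rw [smul_btmul]
        obtain ⟨σ, hσ⟩ := exists_eq_mul_trivIdem_of_heckeOrder Γ' a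
        refine Subtype.ext ?_
        refine Eq.trans ?_ (coe_invariantsModule_smul Γ' hgood hO hΓ hσ _).symm
        change leftInv.incl Γ' O (a • x) • g = σ • leftInv.incl Γ' O x • g
        rw [smul_smul]
        congr 1
        refine Subtype.ext ?_
        change a.1 * x.1 = σ.1 * x.1
        rw [hσ, mul_assoc, ((mem_leftInv_iff Γ' O).1 x.2).2]
      | add x y hx hy => rw [smul_add, map_add, map_add, smul_add, hx, hy] }

theorem coe_tensorToInvariants_btmul (x : (leftInv Γ' O).Elt) (g : G) :
    letI := invariantsModule Γ' hgood hO hΓ G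
    (tensorToInvariants Γ' hgood hO hΓ G (btmul _ _ x g) : G) = leftInv.incl Γ' O x • g := rfl

/-- The Morita argument again, using ε ∈ LP: for l ∈ L and σ ∈ Λ, (lσe₁')y = l ⊗ σψ(y) on the tensor
product, and (lσe₁')g = ψ(l ⊗ σg) on invariants. -/
theorem tensorToInvariants_bijective :
    letI := invariantsModule Γ' hgood hO hΓ G
    Function.Bijective (tensorToInvariants Γ' hgood hO hΓ G) := by
  let _ := invariantsModule Γ' hgood hO hΓ G
  have hle := leftInv_mul_rightProj_le Γ' O
  have hone := augIdem_mul_trivIdem_mem_leftInv_mul_rightProj Γ' hgood hO hΓ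
  have hone' : (heckeOrder Γ' O).elt _ (hle hone) = 1 := rfl
  constructor
  · rw [injective_iff_map_eq_zero]
    intro x hx
    have h : ∀ t (ht : t ∈ (leftInv Γ' O).toSubmodule * (rightProj Γ' O).toSubmodule),
        (heckeOrder Γ' O).elt t (hle ht) • x = 0 := by
      intro t ht
      induction ht using Submodule.mul_induction_on' with
      | mem_mul_mem l hl p hp =>
        obtain ⟨σ, hσ, rfl⟩ := id hp
        have key : ∀ y : BTensor (heckeOrder Γ' O).Elt (eO Γ' O).Elt (leftInv Γ' O).Elt G,
            (heckeOrder Γ' O).elt _ (hle (Submodule.mul_mem_mul hl hp)) • y =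
              btmul _ _ ((leftInv Γ' O).elt l hl)
                ((eO Γ' O).elt σ hσ • (tensorToInvariants Γ' hgood hO hΓ G y : G)) := by
          intro y
          induction y using BTensor.induction with
          | zero => rw [smul_zero, map_zero, ZeroMemClass.coe_zero, smul_zero, btmul_zero]
          | tmul x g =>
            rw [coe_tensorToInvariants_btmul, smul_btmul, smul_smul, ← op_smul_btmul]
            congr 1
            refine Subtype.ext ?_
            change l * (σ * trivIdem Γ') * x.1 = l * (σ * x.1)
            rw [mul_assoc, mul_assoc, ((mem_leftInv_iff Γ' O).1 x.2).2]
          | add y z hy hz =>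
            rw [smul_add, map_add, AddSubgroup.coe_add, smul_add, btmul_add, hy, hz]
        rw [key, hx, ZeroMemClass.coe_zero, smul_zero, btmul_zero]
      | add s hs t ht hs' ht' =>
        have : (heckeOrder Γ' O).elt (s + t) (hle (Submodule.add_mem _ hs ht)) =
          (heckeOrder Γ' O).elt s (hle hs) + (heckeOrder Γ' O).elt t (hle ht) := rfl
        rw [this, add_smul, hs', ht', add_zero]
    exact (one_smul _ x).symm.trans (h _ hone)
  · intro g
    have h : ∀ t (ht : t ∈ (leftInv Γ' O).toSubmodule * (rightProj Γ' O).toSubmodule),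
        (heckeOrder Γ' O).elt t (hle ht) • g ∈
          LinearMap.range (tensorToInvariants Γ' hgood hO hΓ G) := by
      intro t ht
      induction ht using Submodule.mul_induction_on' with
      | mem_mul_mem l hl p hp =>
        obtain ⟨σ, hσ, rfl⟩ := id hp
        refine ⟨btmul _ _ ((leftInv Γ' O).elt l hl) ((eO Γ' O).elt σ hσ • (g : G)),
          Subtype.ext ?_⟩
        rw [coe_tensorToInvariants_btmul, coe_invariantsModule_smul Γ' hgood hO hΓ
          (σ := leftInv.incl Γ' O ((leftInv Γ' O).elt l hl) * (eO Γ' O).elt σ hσ), mul_smul]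
        exact (mul_assoc _ _ _).symm
      | add s hs t ht hs' ht' =>
        have : (heckeOrder Γ' O).elt (s + t) (hle (Submodule.add_mem _ hs ht)) =
          (heckeOrder Γ' O).elt s (hle hs) + (heckeOrder Γ' O).elt t (hle ht) := rfl
        rw [this, add_smul]
        exact Submodule.add_mem _ hs' ht'
    have h1 := h _ hone
    rwa [hone', one_smul] at h1

end Invariants

end HeckeModel

end

/-! ### The main theorem. -/

theorem mainTheorem5 {Γ : Type u} [Group Γ] [Finite Γ] (Γ' : Subgroup Γ)
    (S : Set Nat.Primes) (hS : S.Finite)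
    (hgood : ∀ p ∈ S, HeckeModel.IsGoodPrime p (HeckeModel.augIdem Γ'))
    (O : Subalgebra (HeckeModel.zS S) (MonoidAlgebra ℚ Γ))
    (hmax : HeckeModel.IsMaximalOrder (HeckeModel.zS S) 1 (Subalgebra.toSubmodule O))
    (hO : HeckeModel.groupRing (HeckeModel.zS S) Γ ≤ Subalgebra.toSubmodule O) :
    -- the two rings are Morita equivalent, as algebras over `ℤ_S`
    IsMoritaEquivalent (HeckeModel.zS S)
      (HeckeModel.eO Γ' O).Elt (HeckeModel.heckeOrder Γ' O).Elt ∧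
    -- the two tensor functors are mutually inverse equivalences
    (∃ E : ModuleCat.{max u v} (HeckeModel.eO Γ' O).Elt ≌
        ModuleCat.{max u v} (HeckeModel.heckeOrder Γ' O).Elt,
      E.functor = HeckeModel.tensorFunctor.{u, v} (HeckeModel.heckeOrder Γ' O).Elt
        (HeckeModel.eO Γ' O).Elt (HeckeModel.leftInv Γ' O).Elt ∧
      E.inverse = HeckeModel.tensorFunctor.{u, v} (HeckeModel.eO Γ' O).Elt
        (HeckeModel.heckeOrder Γ' O).Elt (HeckeModel.rightProj Γ' O).Elt) ∧
    -- `x ⊗ g ↦ x g` identifies the first functor with the `Γ'`-invariants, on which `o` acts by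
    -- `(σ e₁') g = σ g`
    (∀ (G : Type v) [AddCommGroup G] [Module (HeckeModel.eO Γ' O).Elt G],
      ∃ _ : Module (HeckeModel.heckeOrder Γ' O).Elt (HeckeModel.invariants Γ' hO G),
        (∀ (a : (HeckeModel.heckeOrder Γ' O).Elt) (σ : (HeckeModel.eO Γ' O).Elt),
          a.1 = σ.1 * HeckeModel.trivIdem Γ' →
          ∀ g : HeckeModel.invariants Γ' hO G, ((a • g : HeckeModel.invariants Γ' hO G) : G)
            = σ • (g : G)) ∧
        ∃ ψ : HeckeModel.BTensor (HeckeModel.heckeOrder Γ' O).Elt (HeckeModel.eO Γ' O).Elt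
            (HeckeModel.leftInv Γ' O).Elt G ≃ₗ[(HeckeModel.heckeOrder Γ' O).Elt]
            HeckeModel.invariants Γ' hO G,
          ∀ (x : (HeckeModel.leftInv Γ' O).Elt) (g : G),
            ((ψ (HeckeModel.btmul _ _ x g) : HeckeModel.invariants Γ' hO G) : G) =
              HeckeModel.leftInv.incl Γ' O x • g) := by
  have hord := hmax.1
  have hPQ := HeckeModel.rightProj_mul_leftInv_le Γ' O
  have hQP := HeckeModel.leftInv_mul_rightProj_le Γ' O
  have hB := HeckeModel.augIdem_mem_rightProj_mul_leftInv Γ' hO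
    (HeckeModel.isMaximalOrder_eO Γ' hgood hord hO)
  have hC := HeckeModel.augIdem_mul_trivIdem_mem_leftInv_mul_rightProj Γ' hgood hord hO
  refine ⟨(HeckeModel.rightProj Γ' O).isMoritaEquivalent (HeckeModel.leftInv Γ' O) hPQ hQP hB hC,
    ⟨(HeckeModel.rightProj Γ' O).equivalence (HeckeModel.leftInv Γ' O) hPQ hQP hB hC, rfl, rfl⟩,
    fun G _ _ => ⟨HeckeModel.invariantsModule Γ' hgood hord hO G, ?_, ?_⟩⟩
  · exact fun a σ h g => HeckeModel.coe_invariantsModule_smul Γ' hgood hord hO h g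
  · let _ := HeckeModel.invariantsModule Γ' hgood hord hO G
    exact ⟨LinearEquiv.ofBijective _ (HeckeModel.tensorToInvariants_bijective Γ' hgood hord hO),
      fun x g => HeckeModel.coe_tensorToInvariants_btmul Γ' hgood hord hO x g⟩
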